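/- All Hilbert spaces are finite-dimensional and complex, each with a fixed orthonormal (computational) basis. Let $P, F$ be Hilbert spaces and let $A_I, A_O, B_I, B_O$ be nonzero Hilbert spaces. A unitary operator is allowed to have different domain and range. **Conventions.** For an operator $V:\mathcal H\to\mathcal K$ put $|V\rangle\!\rangle=\sum_i|i\rangle\otimes V|i\rangle$; for a linear map $\mathcal E:\mathcal L(\mathcal H)\to\mathcal L(\mathcal K)$ its Choi operator is $\sum_{i,i'}|i\rangle\langle i'|\otimes\mathcal E(|i\rangle\langle i'|)$. A channel is a completely positive trace-preserving map. The link product of $E\in\mathcal L(X\otimes Y)$ and $G\in\mathcal L(Y\otimes Z)$ is $E*G=\mathrm{Tr}_Y[(E\otimes 1_Z)(1_X\otimes G^{T_Y})]$. Auxiliary spaces (marked with a prime) range over all finite-dimensional Hilbert spaces. * An operator $S$ on $P\otimes A_O\otimes A_I\otimes F$ is the Choi operator of a *one-slot superchannel* $[\mathcal L(A_I)\to\mathcal L(A_O)]\to[\mathcal L(P)\to\mathcal L(F)]$ if for all auxiliary $A_I',A_O'$ and every channel $\mathcal L(A_I\otimes A_I')\to\mathcal L(A_O\otimes A_O')$ with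 Choi operator $E$, $S*E$ is the Choi operator of a channel $\mathcal L(P\otimes A_I')\to\mathcal L(F\otimes A_O')$. * An operator $W$ on $P\otimes A_O\otimes B_O\otimes A_I\otimes B_I\otimes F$ is the Choi operator of a *two-slot superchannel* if for all auxiliary $A_I',A_O',B_I',B_O'$ and all channels $\mathcal L(A_I\otimes A_I')\to\mathcal L(A_O\otimes A_O')$, $\mathcal L(B_I\otimes B_I')\to\mathcal L(B_O\otimes B_O')$ with Choi operators $E_A,E_B$, $W*(E_A\otimes E_B)$ is the Choi operator of a channel $\mathcal L(P\otimes A_I'\otimes B_I')\to\mathcal L(F\otimes A_O'\otimes B_O')$. It is *pure* if moreover for all auxiliary spaces and all unitaries $U_A:A_I\otimes A_I'\to A_O\otimes A_O'$, $U_B:B_I\otimes B_I'\to B_O\otimes B_O'$ there is a unitary $U_G:P\otimes A_I'\otimes B_I'\to F\otimes A_O'\otimes B_O'$ with $|U_G\rangle\!\rangle\langle\!\langle U_G|=W*(|U_A\rangle\!\rangle\langle\!\langle U_A|\otimes|U_B\rangle\!\rangle\langle\!\langle U_B|)$. * An operator $R$ on $P\otimes A_O\otimes B_O\otimes A_I\otimes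 B_I\otimes F$ is the Choi operator of a *comb of order $A\prec B$* if for all auxiliary $A_I',B_O'$ and every Choi operator $S$ of a one-slot superchannel $[\mathcal L(A_O)\to\mathcal L(B_I)]\to[\mathcal L(A_I\otimes A_I')\to\mathcal L(B_O\otimes B_O')]$, $R*S$ is the Choi operator of a channel $\mathcal L(P\otimes A_I')\to\mathcal L(F\otimes B_O')$. Combs of order $B\prec A$ are defined with the roles of $A$ and $B$ exchanged. * A unitary $U$ *represents* a pure superchannel, or a comb, if $|U\rangle\!\rangle\langle\!\langle U|$ is the Choi operator of one. **Theorem.** Let $U:P\otimes A_O\otimes B_O\to A_I\otimes B_I\otimes F$ be unitary. The following are equivalent. 1. $U$ represents a pure superchannel with two slots $A$ and $B$. 2. For all $\pi,\pi'\in P$; all $\alpha,\alpha',\alpha^\perp\in A_O$ with $\alpha\perp\alpha^\perp$; all $\beta,\beta',\beta^\perp\in B_O$ with $\beta\perp\beta^\perp$; all $\Gamma,\Gamma'\in A_I\otimes B_I$; all $\phi,\phi'\in A_I$; and all $\psi,\psi'\in B_I$ (vectors need not be normalized): * (a) $\langle\!\langle\Gamma|\,U(\pi\otimes\alpha\otimes\beta)\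 \perp\ \langle\!\langle\Gamma'|\,U(\pi'\otimes\alpha^\perp\otimes\beta^\perp)$ in $F$; * (b) $\langle\psi|\,U(\pi\otimes\alpha\otimes\beta)\ \perp\ \langle\psi'|\,U(\pi'\otimes\alpha'\otimes\beta^\perp)$ in $A_I\otimes F$; * (c) $\langle\phi|\,U(\pi\otimes\alpha\otimes\beta)\ \perp\ \langle\phi'|\,U(\pi'\otimes\alpha^\perp\otimes\beta')$ in $B_I\otimes F$, where $\langle\!\langle\Gamma|$, $\langle\psi|$, $\langle\phi|$ denote partial inner products over $A_I\otimes B_I$, $B_I$, $A_I$ respectively. 3. $U$ represents a direct sum of pure combs: there are orthogonal decompositions $P=P^{A\prec B}\oplus P^{B\prec A}$ and $F=F^{A\prec B}\oplus F^{B\prec A}$ (summands may be zero) and unitary operators $U^{A\prec B}:P^{A\prec B}\otimes A_O\otimes B_O\to A_I\otimes B_I\otimes F^{A\prec B}$ representing a comb of order $A\prec B$ and $U^{B\prec A}:P^{B\prec A}\otimes A_O\otimes B_O\to A_I\otimes B_I\otimes F^{B\prec A}$ representing a comb of order $B\prec A$, such that $U=U^{A\prec B}\oplus U^{B\prec A}$.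 -/

import Mathlib

open scoped Matrix Kronecker ComplexOrder InnerProductSpace

noncomputable section

namespace PureSuperchannel

/-! A finite-dimensional Hilbert space with a fixed computational basis is given by the finite type
indexing that basis; operators between such spaces are complex matrices, a tensor product of spaces
corresponds to a product of index types, and auxiliary spaces are indexed by `Fin n`. -/

section Channels

variable {i o x y z : Type*}

/-- Unitary operators; domain and range may differ. -/
def IsUnitary [Fintype i] [DecidableEq i] [Fintype o] [DecidableEq o]
    (U : Matrix o i ℂ) : Prop :=
  Uᴴ * U = 1 ∧ U * Uᴴ = 1

/-- The map `E ⊗ id` acting on operators on `i ⊗ k`. -/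
def ampliation (E : Matrix i i ℂ →ₗ[ℂ] Matrix o o ℂ) (k : Type*)
    (X : Matrix (i × k) (i × k) ℂ) : Matrix (o × k) (o × k) ℂ :=
  Matrix.of fun r s => E (Matrix.of fun a b => X (a, r.2) (b, s.2)) r.1 s.1

/-- Complete positivity: `E ⊗ id` preserves positivity for every finite-dimensional ancilla. -/
def IsCompletelyPositive (E : Matrix i i ℂ →ₗ[ℂ] Matrix o o ℂ) : Prop :=
  ∀ (n : ℕ) (X : Matrix (i × Fin n) (i × Fin n) ℂ),
    X.PosSemidef → (ampliation E (Fin n) X).PosSemidef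

/-- Quantum channels: completely positive trace-preserving maps. -/
def IsChannel [Fintype i] [Fintype o] (E : Matrix i i ℂ →ₗ[ℂ] Matrix o o ℂ) : Prop :=
  IsCompletelyPositive E ∧ ∀ X : Matrix i i ℂ, (E X).trace = X.trace

/-- The Choi operator `∑ |a⟩⟨b| ⊗ E(|a⟩⟨b|)`. -/
def choi [DecidableEq i] (E : Matrix i i ℂ →ₗ[ℂ] Matrix o o ℂ) : Matrix (i × o) (i × o) ℂ :=
  Matrix.of fun r s => E (Matrix.single r.1 s.1 1) r.2 s.2

/-- The Choi vector `|U⟩⟩ = ∑ |a⟩ ⊗ U|a⟩`. -/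
def choiVec (U : Matrix o i ℂ) : i × o → ℂ := fun r => U r.2 r.1

/-- The rank-one operator `|U⟩⟩⟨⟨U|`. -/
def choiProj (U : Matrix o i ℂ) : Matrix (i × o) (i × o) ℂ :=
  Matrix.vecMulVec (choiVec U) (star (choiVec U))

/-- The link product `Tr_y[(E ⊗ 1_z)(1_x ⊗ F^{T_y})]`, written out in the computational basis. -/
def link [Fintype y] (E : Matrix (x × y) (x × y) ℂ) (F : Matrix (y × z) (y × z) ℂ) :
    Matrix (x × z) (x × z) ℂ :=
  Matrix.of fun r s => ∑ k, ∑ l, E (r.1, k) (s.1, l) * F (k, r.2) (l, s.2)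

end Channels

section Supermaps

variable {p aI aO bI bO f : Type*}

/-! The Choi operator of a supermap `[L(aI) → L(aO)] → [L(p) → L(f)]` is a matrix on
`(p ⊗ aO) ⊗ (aI ⊗ f)`, and that of a supermap with two slots a matrix on
`(p ⊗ aO ⊗ bO) ⊗ (aI ⊗ bI ⊗ f)`. -/

/-- The link product of a one-slot `W` with an operator `X` on `(aI ⊗ aI') ⊗ (aO ⊗ aO')`,
taken over `aI` and `aO`, with the result arranged on `(p ⊗ aI') ⊗ (f ⊗ aO')`. -/
def plugOne [Fintype aI] [Fintype aO] {aI' aO' : Type*}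
    (W : Matrix ((p × aO) × (aI × f)) ((p × aO) × (aI × f)) ℂ)
    (X : Matrix ((aI × aI') × (aO × aO')) ((aI × aI') × (aO × aO')) ℂ) :
    Matrix ((p × aI') × (f × aO')) ((p × aI') × (f × aO')) ℂ :=
  let eW : (p × f) × (aI × aO) → (p × aO) × (aI × f) :=
    fun r => ((r.1.1, r.2.2), (r.2.1, r.1.2))
  let eX : (aI × aO) × (aI' × aO') → (aI × aI') × (aO × aO') :=
    fun r => ((r.1.1, r.2.1), (r.1.2, r.2.2))
  let eG : (p × aI') × (f × aO') → (p × f) × (aI' × aO') :=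
    fun r => ((r.1.1, r.2.1), (r.1.2, r.2.2))
  (link (W.submatrix eW eW) (X.submatrix eX eX)).submatrix eG eG

/-- The link product of a two-slot `W` with `X ⊗ Y`, where `X` is an operator on
`(aI ⊗ aI') ⊗ (aO ⊗ aO')` and `Y` one on `(bI ⊗ bI') ⊗ (bO ⊗ bO')`, with the result arranged on
`(p ⊗ aI' ⊗ bI') ⊗ (f ⊗ aO' ⊗ bO')`. -/
def plugTwo [Fintype aI] [Fintype aO] [Fintype bI] [Fintype bO] {aI' aO' bI' bO' : Type*}
    (W : Matrix ((p × aO × bO) × (aI × bI × f)) ((p × aO × bO) × (aI × bI × f)) ℂ)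
    (X : Matrix ((aI × aI') × (aO × aO')) ((aI × aI') × (aO × aO')) ℂ)
    (Y : Matrix ((bI × bI') × (bO × bO')) ((bI × bI') × (bO × bO')) ℂ) :
    Matrix ((p × aI' × bI') × (f × aO' × bO')) ((p × aI' × bI') × (f × aO' × bO')) ℂ :=
  let eW : (p × f) × ((aI × aO) × (bI × bO)) → (p × aO × bO) × (aI × bI × f) :=
    fun r => ((r.1.1, r.2.1.2, r.2.2.2), (r.2.1.1, r.2.2.1, r.1.2))
  let eXY : ((aI × aO) × (bI × bO)) × ((aI' × aO') × (bI' × bO')) →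
      ((aI × aI') × (aO × aO')) × ((bI × bI') × (bO × bO')) :=
    fun r => (((r.1.1.1, r.2.1.1), (r.1.1.2, r.2.1.2)), ((r.1.2.1, r.2.2.1), (r.1.2.2, r.2.2.2)))
  let eG : (p × aI' × bI') × (f × aO' × bO') → (p × f) × ((aI' × aO') × (bI' × bO')) :=
    fun r => ((r.1.1, r.2.1), ((r.1.2.1, r.2.2.1), (r.1.2.2, r.2.2.2)))
  (link (W.submatrix eW eW) ((X ⊗ₖ Y).submatrix eXY eXY)).submatrix eG eG

/-- The link product of a two-slot `R` with the Choi operator `S` of a one-slot supermap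
`[L(aO) → L(bI)] → [L(aI ⊗ aI') → L(bO ⊗ bO')]`, with the result arranged on
`(p ⊗ aI') ⊗ (f ⊗ bO')`. -/
def plugComb [Fintype aI] [Fintype aO] [Fintype bI] [Fintype bO] {aI' bO' : Type*}
    (R : Matrix ((p × aO × bO) × (aI × bI × f)) ((p × aO × bO) × (aI × bI × f)) ℂ)
    (S : Matrix (((aI × aI') × bI) × (aO × (bO × bO'))) (((aI × aI') × bI) × (aO × (bO × bO'))) ℂ) :
    Matrix ((p × aI') × (f × bO')) ((p × aI') × (f × bO')) ℂ :=
  let eR : (p × f) × ((aI × aO) × (bI × bO)) → (p × aO × bO) × (aI × bI × f) :=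
    fun r => ((r.1.1, r.2.1.2, r.2.2.2), (r.2.1.1, r.2.2.1, r.1.2))
  let eS : ((aI × aO) × (bI × bO)) × (aI' × bO') → ((aI × aI') × bI) × (aO × (bO × bO')) :=
    fun r => (((r.1.1.1, r.2.1), r.1.2.1), (r.1.1.2, (r.1.2.2, r.2.2)))
  let eG : (p × aI') × (f × bO') → (p × f) × (aI' × bO') :=
    fun r => ((r.1.1, r.2.1), (r.1.2, r.2.2))
  (link (R.submatrix eR eR) (S.submatrix eS eS)).submatrix eG eG

/-- Exchange of the two slots. -/
def swapSlots
    (W : Matrix ((p × aO × bO) × (aI × bI × f)) ((p × aO × bO) × (aI × bI × f)) ℂ) :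
    Matrix ((p × bO × aO) × (bI × aI × f)) ((p × bO × aO) × (bI × aI × f)) ℂ :=
  let e : (p × bO × aO) × (bI × aI × f) → (p × aO × bO) × (aI × bI × f) :=
    fun r => ((r.1.1, r.1.2.2, r.1.2.1), (r.2.2.1, r.2.1, r.2.2.2))
  W.submatrix e e

variable [Fintype p] [DecidableEq p] [Fintype f] [DecidableEq f]
  [Fintype aI] [DecidableEq aI] [Fintype aO] [DecidableEq aO]
  [Fintype bI] [DecidableEq bI] [Fintype bO] [DecidableEq bO]

/-- `W` is the Choi operator of a quantum superchannel with one slot (equivalently by definition,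
of a quantum comb with one slot). -/
def IsOneSlotSuperchannel
    (W : Matrix ((p × aO) × (aI × f)) ((p × aO) × (aI × f)) ℂ) : Prop :=
  ∀ (m n : ℕ)
    (E : Matrix (aI × Fin m) (aI × Fin m) ℂ →ₗ[ℂ] Matrix (aO × Fin n) (aO × Fin n) ℂ),
    IsChannel E →
    ∃ G : Matrix (p × Fin m) (p × Fin m) ℂ →ₗ[ℂ] Matrix (f × Fin n) (f × Fin n) ℂ,
      IsChannel G ∧ choi G = plugOne W (choi E)

/-- `W` is the Choi operator of a quantum superchannel with two slots. -/
def IsTwoSlotSuperchannel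
    (W : Matrix ((p × aO × bO) × (aI × bI × f)) ((p × aO × bO) × (aI × bI × f)) ℂ) : Prop :=
  ∀ (m n m' n' : ℕ)
    (E : Matrix (aI × Fin m) (aI × Fin m) ℂ →ₗ[ℂ] Matrix (aO × Fin n) (aO × Fin n) ℂ)
    (E' : Matrix (bI × Fin m') (bI × Fin m') ℂ →ₗ[ℂ] Matrix (bO × Fin n') (bO × Fin n') ℂ),
    IsChannel E → IsChannel E' →
    ∃ G : Matrix (p × Fin m × Fin m') (p × Fin m × Fin m') ℂ →ₗ[ℂ]
        Matrix (f × Fin n × Fin n') (f × Fin n × Fin n') ℂ,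
      IsChannel G ∧ choi G = plugTwo W (choi E) (choi E')

/-- `W` is the Choi operator of a pure quantum superchannel with two slots: a superchannel that maps
pairs of unitary channels, possibly acting on auxiliary systems, to unitary channels. -/
def IsPureTwoSlotSuperchannel
    (W : Matrix ((p × aO × bO) × (aI × bI × f)) ((p × aO × bO) × (aI × bI × f)) ℂ) : Prop :=
  IsTwoSlotSuperchannel W ∧
  ∀ (m n m' n' : ℕ)
    (UA : Matrix (aO × Fin n) (aI × Fin m) ℂ) (UB : Matrix (bO × Fin n') (bI × Fin m') ℂ),
    IsUnitary UA → IsUnitary UB →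
    ∃ UG : Matrix (f × Fin n × Fin n') (p × Fin m × Fin m') ℂ,
      IsUnitary UG ∧ choiProj UG = plugTwo W (choiProj UA) (choiProj UB)

/-- `R` is the Choi operator of a quantum comb of `A ≺ B`: it maps every comb with one slot
`[L(aO) → L(bI)] → [L(aI ⊗ aI') → L(bO ⊗ bO')]` to a channel `L(p ⊗ aI') → L(f ⊗ bO')`. -/
def IsCombAB
    (R : Matrix ((p × aO × bO) × (aI × bI × f)) ((p × aO × bO) × (aI × bI × f)) ℂ) : Prop :=
  ∀ (m n : ℕ)
    (S : Matrix (((aI × Fin m) × bI) × (aO × (bO × Fin n)))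
      (((aI × Fin m) × bI) × (aO × (bO × Fin n))) ℂ),
    IsOneSlotSuperchannel S →
    ∃ G : Matrix (p × Fin m) (p × Fin m) ℂ →ₗ[ℂ] Matrix (f × Fin n) (f × Fin n) ℂ,
      IsChannel G ∧ choi G = plugComb R S

/-- `R` is the Choi operator of a quantum comb of `B ≺ A`. -/
def IsCombBA
    (R : Matrix ((p × aO × bO) × (aI × bI × f)) ((p × aO × bO) × (aI × bI × f)) ℂ) : Prop :=
  IsCombAB (swapSlots R)

/-- `U` represents a pure quantum superchannel with two slots `A` and `B`. -/
def RepresentsPureSuperchannel (U : Matrix (aI × bI × f) (p × aO × bO) ℂ) : Prop :=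
  IsPureTwoSlotSuperchannel (choiProj U)

/-- The inclusion `S → ℂ^x` of a subspace `S`, as a matrix with respect to an orthonormal basis of
`S`. -/
def inclusion {x : Type*} [Fintype x] {n : ℕ} {S : Submodule ℂ (EuclideanSpace ℂ x)}
    (e : OrthonormalBasis (Fin n) ℂ S) : Matrix x (Fin n) ℂ :=
  Matrix.of fun k t => (e t : EuclideanSpace ℂ x) k

/-- For `V : P' ⊗ aO ⊗ bO → aI ⊗ bI ⊗ F'` with subspaces `P'` of `p` and `F'` of `f`, given by its
matrix with respect to orthonormal bases of `P'` and `F'`, the operator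
`p ⊗ aO ⊗ bO → aI ⊗ bI ⊗ f` that acts as `V` on `P' ⊗ aO ⊗ bO` and as zero on the orthogonal
complement. -/
def extendByZero {m n : ℕ} {P' : Submodule ℂ (EuclideanSpace ℂ p)}
    {F' : Submodule ℂ (EuclideanSpace ℂ f)}
    (eP : OrthonormalBasis (Fin m) ℂ P') (eF : OrthonormalBasis (Fin n) ℂ F')
    (V : Matrix (aI × bI × Fin n) (Fin m × aO × bO) ℂ) :
    Matrix (aI × bI × f) (p × aO × bO) ℂ :=
  ((1 : Matrix aI aI ℂ) ⊗ₖ ((1 : Matrix bI bI ℂ) ⊗ₖ inclusion eF)) * V *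
    ((inclusion eP)ᴴ ⊗ₖ ((1 : Matrix aO aO ℂ) ⊗ₖ (1 : Matrix bO bO ℂ)))

/-- `U` represents a direct sum of pure combs: there are orthogonal decompositions
`p = P₁ ⊕ P₂`, `f = F₁ ⊕ F₂`, and unitary operators `U₁ : P₁ ⊗ aO ⊗ bO → aI ⊗ bI ⊗ F₁`
representing a quantum comb of `A ≺ B` and `U₂ : P₂ ⊗ aO ⊗ bO → aI ⊗ bI ⊗ F₂` representing a
quantum comb of `B ≺ A`, such that `U = U₁ ⊕ U₂`. The summands may be zero. -/
def IsDirectSumOfPureCombs (U : Matrix (aI × bI × f) (p × aO × bO) ℂ) : Prop :=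
  ∃ (P₁ P₂ : Submodule ℂ (EuclideanSpace ℂ p)) (F₁ F₂ : Submodule ℂ (EuclideanSpace ℂ f)),
    P₁ ⟂ P₂ ∧ P₁ ⊔ P₂ = ⊤ ∧ F₁ ⟂ F₂ ∧ F₁ ⊔ F₂ = ⊤ ∧
    ∃ (m₁ m₂ n₁ n₂ : ℕ)
      (eP₁ : OrthonormalBasis (Fin m₁) ℂ P₁) (eP₂ : OrthonormalBasis (Fin m₂) ℂ P₂)
      (eF₁ : OrthonormalBasis (Fin n₁) ℂ F₁) (eF₂ : OrthonormalBasis (Fin n₂) ℂ F₂)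
      (U₁ : Matrix (aI × bI × Fin n₁) (Fin m₁ × aO × bO) ℂ)
      (U₂ : Matrix (aI × bI × Fin n₂) (Fin m₂ × aO × bO) ℂ),
      IsUnitary U₁ ∧ IsCombAB (choiProj U₁) ∧
      IsUnitary U₂ ∧ IsCombBA (choiProj U₂) ∧
      U = extendByZero eP₁ eF₁ U₁ + extendByZero eP₂ eF₂ U₂

end Supermaps

section Orthogonality

variable {p aI aO bI bO f : Type*}

/-- Orthogonality of vectors, `⟨u|v⟩ = 0`. -/
def Perp {x : Type*} [Fintype x] (u v : x → ℂ) : Prop := star u ⬝ᵥ v = 0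

/-- The product vector `|π⟩|α⟩|β⟩`. -/
def ket (π : p → ℂ) (α : aO → ℂ) (β : bO → ℂ) : p × aO × bO → ℂ :=
  fun r => π r.1 * α r.2.1 * β r.2.2

/-- The partial inner product `⟨⟨Γ|η⟩` over `aI ⊗ bI`. -/
def braAB [Fintype aI] [Fintype bI] (Γ : aI × bI → ℂ) (η : aI × bI × f → ℂ) : f → ℂ :=
  fun k => ∑ i, ∑ j, star (Γ (i, j)) * η (i, j, k)

/-- The partial inner product `⟨ψ|η⟩` over `bI`. -/
def braB [Fintype bI] (ψ : bI → ℂ) (η : aI × bI × f → ℂ) : aI × f → ℂ :=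
  fun r => ∑ j, star (ψ j) * η (r.1, j, r.2)

/-- The partial inner product `⟨φ|η⟩` over `aI`. -/
def braA [Fintype aI] (φ : aI → ℂ) (η : aI × bI × f → ℂ) : bI × f → ℂ :=
  fun r => ∑ i, star (φ i) * η (i, r.1, r.2)

variable [Fintype p] [Fintype f] [Fintype aI] [Fintype aO] [Fintype bI] [Fintype bO]

/-- The three orthogonality conditions (a), (b), (c) on `U`. -/
def OrthogonalityConditions (U : Matrix (aI × bI × f) (p × aO × bO) ℂ) : Prop :=
  ∀ (π π' : p → ℂ) (α α' αp : aO → ℂ) (β β' βp : bO → ℂ)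
    (Γ Γ' : aI × bI → ℂ) (φ φ' : aI → ℂ) (ψ ψ' : bI → ℂ),
    Perp α αp → Perp β βp →
      Perp (braAB Γ (U *ᵥ ket π α β)) (braAB Γ' (U *ᵥ ket π' αp βp)) ∧
      Perp (braB ψ (U *ᵥ ket π α β)) (braB ψ' (U *ᵥ ket π' α' βp)) ∧
      Perp (braA φ (U *ᵥ ket π α β)) (braA φ' (U *ᵥ ket π' αp β'))

end Orthogonality

end PureSuperchannel

end

/-! All trace conditions on what `U` produces when its slots are filled depend only on `gram U`, the
operator left from `choiProj U` after tracing out F. For a unitary `U`, each of the three statements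
is equivalent to `GramConditions U`: `gram U` is a sum of a part trivial on A_O and a part trivial
on B_O, and tracing out one slot's input leaves something trivial on the other slot's output.

Orthogonality. The inner products in (a), (b), (c) are contractions of `gram U`, and a sesquilinear
form that vanishes on all orthonormal pairs is a multiple of the standard one
(`exists_eq_ite_of_orthonormal`).

Superchannels. Inserting unitaries with ancillas must give an isometry, so the blocks between
different ancilla inputs vanish. Sign changes of single columns isolate one pair of columns of the
inserted unitary, and such a pair is an arbitrary orthonormal pair; the same scalar criterion then
applies (`exists_eq_ite_of_unitary`). Conversely, inclusion-exclusion writes `gram U` as T₁ + T₂ -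
T₃, each term trivial on at least one output. Every term contributes the correct trace, and 1 + 1 -
1 = 1 (`GramConditions.sum_gram_mul`). Unitarity of the result follows by counting dimensions.

Direct sums. A comb of order A ≺ B has `gram` trivial on B_O, and one of order B ≺ A has it trivial
on A_O; orthogonality of the F summands removes cross terms, so the sum satisfies the conditions.
Conversely, Uᴴ(A ⊗ 1 ⊗ 1)U is trivial on A_O and Uᴴ(1 ⊗ B ⊗ 1)U on B_O. Their blocks `blockA` and
`blockB` are operators on P, and they commute. Subtracting from them what is trivial on the
remaining output gives `offA` and `offB`, which satisfy `offB * offA = 0`. The span P₂ of the ranges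
of all `offA` reduces every block, is annihilated by every `offB`, and its complement is annihilated
by every `offA`. The projection onto P₂, carried through `U`, commutes with all operators on A_I and
on B_I, hence is a projection on F alone. This splits `U` into the two combs. -/

noncomputable section

namespace PureSuperchannel

set_option linter.unusedSectionVars false

/-! ### Choi's theorem and unitaries between different spaces. -/

section ChoiTheorem

variable {i o x y z : Type*}

theorem posSemidef_sum_sum {m n k : Type*} [Fintype n] [Fintype k] [Fintype m] [DecidableEq m]
    {A : Matrix n n ℂ} (hA : A.PosSemidef) (φ : m → k → n) :
    (Matrix.of fun r s => ∑ a, ∑ b, A (φ r a) (φ s b) : Matrix m m ℂ).PosSemidef := by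
  let J : Matrix (m × k) m ℂ := Matrix.of fun r s => if r.1 = s then 1 else 0
  have h := (hA.submatrix fun r : m × k => φ r.1 r.2).conjTranspose_mul_mul_same J
  convert h using 1
  ext r s
  simp [J, Matrix.mul_apply, Fintype.sum_prod_type, apply_ite]
  rw [Finset.sum_comm]

/-- In coordinates the link product is the compression of E ⊗ F by the unnormalized maximally
entangled vector on the two copies of y. -/
theorem link_posSemidef [Fintype x] [DecidableEq x] [Fintype y] [Fintype z] [DecidableEq z]
    {E : Matrix (x × y) (x × y) ℂ} {F : Matrix (y × z) (y × z) ℂ}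
    (hE : E.PosSemidef) (hF : F.PosSemidef) : (link E F).PosSemidef := by
  have h := posSemidef_sum_sum (hE.kronecker hF)
    (fun (r : x × z) (k : y) => ((r.1, k), (k, r.2)))
  simpa [link, Matrix.kroneckerMap_apply] using h

/-- The Choi operator is the image under E ⊗ id of the unnormalized maximally entangled state, with
the ancilla a copy of i indexed by `Fin`. -/
theorem choi_posSemidef [Fintype i] [DecidableEq i] [Fintype o]
    {E : Matrix i i ℂ →ₗ[ℂ] Matrix o o ℂ} (hE : IsCompletelyPositive E) :
    (choi E).PosSemidef := by
  let e := Fintype.equivFin i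
  let w : i × Fin (Fintype.card i) → ℂ := fun r => if e r.1 = r.2 then 1 else 0
  have h := (hE _ _ (Matrix.posSemidef_vecMulVec_self_star w)).submatrix
    (fun r : i × o => (r.2, e r.1))
  convert h using 1
  ext r s
  simp only [choi, ampliation, Matrix.of_apply, Matrix.submatrix_apply]
  refine congrArg (fun M : Matrix o o ℂ => M r.2 s.2) ?_
  refine congrArg E (Matrix.ext fun a b => ?_)
  simp [Matrix.single_apply, Matrix.vecMulVec_apply, w, ite_and, eq_comm]
  split_ifs <;> rfl

theorem choi_trace [DecidableEq i] [Fintype i] [Fintype o]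
    {E : Matrix i i ℂ →ₗ[ℂ] Matrix o o ℂ} (hE : IsChannel E) (a b : i) :
    ∑ k, choi E (a, k) (b, k) = if a = b then 1 else 0 := by
  have h := hE.2 (Matrix.single a b 1)
  rw [Matrix.trace] at h
  simp only [Matrix.diag_apply] at h
  simp only [choi, Matrix.of_apply]
  rw [h]
  split_ifs with hab
  · subst hab; simp
  · simp [hab]

/-- The map with a given Choi operator. -/
def ofChoi [Fintype i] (C : Matrix (i × o) (i × o) ℂ) : Matrix i i ℂ →ₗ[ℂ] Matrix o o ℂ where
  toFun X := Matrix.of fun r s => ∑ a, ∑ b, X a b * C (a, r) (b, s)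
  map_add' X Y := by
    ext r s
    simp [add_mul, Finset.sum_add_distrib]
  map_smul' c X := by
    ext r s
    simp [Finset.mul_sum, mul_assoc]

theorem choi_ofChoi [Fintype i] [DecidableEq i] (C : Matrix (i × o) (i × o) ℂ) :
    choi (ofChoi C) = C := by
  ext r s
  simp [choi, ofChoi, Matrix.single_apply, ite_and]

/-- Every channel condition below is checked on Choi operators through this criterion. Complete
positivity of `ofChoi C` needs no separate argument, since its ampliation at X is the link product
of X with C. -/
theorem exists_channel_iff [Fintype i] [DecidableEq i] [Fintype o] [DecidableEq o]
    {C : Matrix (i × o) (i × o) ℂ} :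
    (∃ G : Matrix i i ℂ →ₗ[ℂ] Matrix o o ℂ, IsChannel G ∧ choi G = C) ↔
      C.PosSemidef ∧ ∀ a b, ∑ k, C (a, k) (b, k) = if a = b then 1 else 0 := by
  constructor
  · rintro ⟨G, hG, rfl⟩
    exact ⟨choi_posSemidef hG.1, choi_trace hG⟩
  · rintro ⟨hC, hT⟩
    refine ⟨ofChoi C, ⟨fun n X hX => ?_, fun X => ?_⟩, choi_ofChoi C⟩
    · have h := (link_posSemidef (hX.submatrix (Prod.swap : Fin n × i → i × Fin n)) hC).submatrix
        (Prod.swap : o × Fin n → Fin n × o)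
      exact h
    · simp only [ofChoi, Matrix.trace, Matrix.diag_apply, LinearMap.coe_mk, AddHom.coe_mk,
        Matrix.of_apply]
      rw [Finset.sum_comm]
      refine Finset.sum_congr rfl fun a _ => ?_
      rw [Finset.sum_comm]
      simp [← Finset.mul_sum, hT]

theorem choiProj_posSemidef [Fintype i] [Fintype o] (U : Matrix o i ℂ) :
    (choiProj U).PosSemidef := Matrix.posSemidef_vecMulVec_self_star _

theorem choiProj_apply (U : Matrix o i ℂ) (r s : i × o) :
    choiProj U r s = U r.2 r.1 * star (U s.2 s.1) := rfl

theorem choiProj_trace [Fintype o] (U : Matrix o i ℂ) (a b : i) :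
    ∑ k, choiProj U (a, k) (b, k) = (Uᴴ * U) b a := by
  simp [choiProj_apply, Matrix.mul_apply, mul_comm]

theorem choiProj_trace_of_isometry [Fintype i] [DecidableEq i] [Fintype o] {U : Matrix o i ℂ}
    (hU : Uᴴ * U = 1) (a b : i) :
    ∑ k, choiProj U (a, k) (b, k) = if a = b then 1 else 0 := by
  rw [choiProj_trace, hU, Matrix.one_apply]
  simp [eq_comm]

theorem exists_channel_choiProj [Fintype i] [DecidableEq i] [Fintype o] [DecidableEq o]
    {U : Matrix o i ℂ} (hU : Uᴴ * U = 1) :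
    ∃ G : Matrix i i ℂ →ₗ[ℂ] Matrix o o ℂ, IsChannel G ∧ choi G = choiProj U := by
  exact exists_channel_iff.2 ⟨choiProj_posSemidef U, choiProj_trace_of_isometry hU⟩

theorem IsUnitary.card_eq [Fintype i] [DecidableEq i] [Fintype o] [DecidableEq o]
    {U : Matrix o i ℂ} (hU : IsUnitary U) : Fintype.card o = Fintype.card i := by
  have h := Matrix.trace_mul_comm Uᴴ U
  rw [hU.1, hU.2, Matrix.trace_one, Matrix.trace_one] at h
  exact_mod_cast h.symm

theorem isUnitary_of_isometry [Fintype i] [DecidableEq i] [Fintype o] [DecidableEq o]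
    {U : Matrix o i ℂ} (h : Uᴴ * U = 1) (hc : Fintype.card o = Fintype.card i) : IsUnitary U :=
  ⟨h, (Matrix.mul_eq_one_comm_of_card_eq _ _ _ hc.symm).1 h⟩

theorem IsUnitary.submatrix {i' o' : Type*} [Fintype i] [DecidableEq i] [Fintype o] [DecidableEq o]
    [Fintype i'] [DecidableEq i'] [Fintype o'] [DecidableEq o']
    {U : Matrix o i ℂ} (hU : IsUnitary U) (e : o' ≃ o) (e' : i' ≃ i) :
    IsUnitary (U.submatrix e e') := by
  constructor
  · rw [Matrix.conjTranspose_submatrix, Matrix.submatrix_mul_equiv, hU.1,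
      Matrix.submatrix_one_equiv]
  · rw [Matrix.conjTranspose_submatrix, Matrix.submatrix_mul_equiv, hU.2,
      Matrix.submatrix_one_equiv]

end ChoiTheorem

/-! ### Ancilla blocks of an operator with its ancilla output traced out. -/

section Reduction

variable {i o ι κ : Type*}

/-- The block with ancilla inputs `y`, `y'` of an operator on `(i ⊗ ι) ⊗ (o ⊗ κ)`, after tracing
out the ancilla output. -/
def reduce [Fintype κ] (E : Matrix ((i × ι) × (o × κ)) ((i × ι) × (o × κ)) ℂ) (y y' : ι) :
    Matrix (i × o) (i × o) ℂ :=
  Matrix.of fun r s => ∑ x, E ((r.1, y), (r.2, x)) ((s.1, y'), (s.2, x))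

theorem reduce_trace [Fintype κ] [Fintype o] [DecidableEq i] [DecidableEq ι]
    {E : Matrix ((i × ι) × (o × κ)) ((i × ι) × (o × κ)) ℂ}
    (hE : ∀ a b, ∑ k, E (a, k) (b, k) = if a = b then 1 else 0) (y y' : ι) (j j' : i) :
    ∑ a, reduce E y y' (j, a) (j', a) = if j = j' then (if y = y' then 1 else 0) else 0 := by
  have h := hE (j, y) (j', y')
  rw [Fintype.sum_prod_type] at h
  simp only [reduce, Matrix.of_apply]
  rw [h]
  simp [Prod.ext_iff, ite_and]

/-- A kernel that is trivial on the output sees e only through its partial trace over o, which is a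
multiple of the identity. -/
theorem sum_mul_eq_of_diagonal [Fintype i] [Fintype o] [DecidableEq i] [DecidableEq o]
    {K : i × o → i × o → ℂ} {e : Matrix (i × o) (i × o) ℂ} {K' : i → i → ℂ} {c : ℂ}
    (hK : ∀ j j' a a', K (j, a) (j', a') = if a = a' then K' j j' else 0)
    (he : ∀ j j', ∑ a, e (j, a) (j', a) = if j = j' then c else 0) :
    ∑ r, ∑ s, K r s * e r s = c * ∑ j, K' j j := by
  have h : ∀ j, ∑ a, ∑ s, K (j, a) s * e (j, a) s = c * K' j j := by
    intro j
    have : ∀ a, ∑ s, K (j, a) s * e (j, a) s = ∑ j', K' j j' * e (j, a) (j', a) := by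
      intro a
      simp [Fintype.sum_prod_type, hK]
    simp only [this]
    rw [Finset.sum_comm]
    simp [← Finset.mul_sum, he, mul_comm]
  rw [Fintype.sum_prod_type]
  simp only [h, Finset.mul_sum]

theorem reduce_choiProj_submatrix {ι' κ' : Type*} [Fintype κ] [Fintype κ']
    (V : Matrix (o × κ) (i × ι) ℂ) (e : κ' ≃ κ) (e' : ι' → ι) (y y' : ι') :
    reduce (choiProj (V.submatrix (Prod.map id e) (Prod.map id e'))) y y' =
      reduce (choiProj V) (e' y) (e' y') := by
  ext r s
  simp only [reduce, choiProj_apply, Matrix.of_apply, Matrix.submatrix_apply, Prod.map, id]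
  exact e.sum_comp (fun x => V (r.2, x) (r.1, e' y) * star (V (s.2, x) (s.1, e' y')))

/-- The exchange of two systems. -/
def exchange (i o : Type*) [DecidableEq i] [DecidableEq o] : Matrix (o × i) (i × o) ℂ :=
  (1 : Matrix (o × i) (o × i) ℂ).submatrix id Prod.swap

theorem exchange_isUnitary [Fintype i] [Fintype o] [DecidableEq i] [DecidableEq o] :
    IsUnitary (exchange i o) := by
  have h : IsUnitary (1 : Matrix (o × i) (o × i) ℂ) := by simp [IsUnitary]
  exact h.submatrix (Equiv.refl _) (Equiv.prodComm i o)

/-- Inserting the swap into a slot discards the slot's input and feeds the ancilla to its output.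
Pairing with it therefore traces out the input at fixed output indices y, y'. -/
theorem reduce_exchange [Fintype i] [DecidableEq i] [DecidableEq o] (y y' : o) (r s : i × o) :
    reduce (choiProj (exchange i o)) y y' r s =
      if r.1 = s.1 then (if r.2 = y then if s.2 = y' then 1 else 0 else 0) else 0 := by
  simp only [reduce, choiProj_apply, exchange, Matrix.of_apply, Matrix.submatrix_apply,
    Matrix.one_apply, id, Prod.swap, Prod.mk.injEq]
  by_cases h1 : r.2 = y <;> by_cases h2 : s.2 = y' <;> simp [h1, h2, eq_comm]

end Reduction

/-! ### Recognizing scalar forms from orthonormal pairs and from unitaries. -/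

section Scalar

variable {i o ι κ : Type*}

theorem exists_eq_ite_of_orthonormal [Fintype o] [DecidableEq o] {K : o → o → ℂ}
    (h : ∀ u v : o → ℂ, star u ⬝ᵥ u = 1 → star v ⬝ᵥ v = 1 → star u ⬝ᵥ v = 0 →
      ∑ a, ∑ b, K a b * (u a * star (v b)) = 0) :
    ∃ t, ∀ a b, K a b = if a = b then t else 0 := by
  have hoff : ∀ a b, a ≠ b → K a b = 0 := by
    intro a b hab
    have := h (Pi.single a 1) (Pi.single b 1) (by simp) (by simp)
      (by simp [hab])
    simpa [Pi.single_apply] using this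
  have hdiag : ∀ a b, K a a = K b b := by
    intro a b
    by_cases hab : a = b
    · rw [hab]
    have hba : b ≠ a := fun h => hab h.symm
    -- A rational orthonormal pair in the plane of a and b, from the triple 3, 4, 5. With the
    -- off-diagonal entries gone it yields (12/25)(K a a - K b b) = 0.
    have key := h (Pi.single a (3 / 5) + Pi.single b (4 / 5))
      (Pi.single a (4 / 5) - Pi.single b (3 / 5))
      (by simp [dotProduct_add, hab, hba]; norm_num)
      (by simp [dotProduct_sub, hab, hba]; norm_num)
      (by simp [dotProduct_sub, hab, hba]; norm_num)
    have hs : ∀ c, ∑ d, K c d * (star ((Pi.single a (4 / 5) - Pi.single b (3 / 5) : o → ℂ) d)) =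
        K c a * (4 / 5) - K c b * (3 / 5) := by
      intro c
      simp only [Pi.sub_apply, star_sub, mul_sub, Finset.sum_sub_distrib]
      simp [Pi.single_apply, apply_ite (starRingEnd ℂ), map_ofNat]
    have hr : ∀ c, ∑ d, K c d * ((Pi.single a (3 / 5) + Pi.single b (4 / 5) : o → ℂ) c *
        star ((Pi.single a (4 / 5) - Pi.single b (3 / 5) : o → ℂ) d)) =
        (Pi.single a (3 / 5) + Pi.single b (4 / 5) : o → ℂ) c *
          (K c a * (4 / 5) - K c b * (3 / 5)) := by
      intro c
      rw [← hs, Finset.mul_sum]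
      exact Finset.sum_congr rfl fun d _ => by ring
    simp only [hr] at key
    simp only [Pi.add_apply, add_mul, Finset.sum_add_distrib, Pi.single_apply, ite_mul, zero_mul,
      Finset.sum_ite_eq', Finset.mem_univ, if_true, hoff a b hab, hoff b a hba] at key
    linear_combination (25 / 12) * key
  rcases isEmpty_or_nonempty o with ho | ⟨⟨a0⟩⟩
  · exact ⟨0, fun a => ho.elim a⟩
  · refine ⟨K a0 a0, fun a b => ?_⟩
    split_ifs with hab
    · rw [hab, hdiag b a0]
    · exact hoff a b hab

theorem sum_eq_zero_of_perp [Fintype o] [DecidableEq o] {K : o → o → ℂ} {t : ℂ}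
    (hK : ∀ a b, K a b = if a = b then t else 0) {u v : o → ℂ} (h : star u ⬝ᵥ v = 0) :
    ∑ a, ∑ b, K a b * (u a * star (v b)) = 0 := by
  have h' : ∑ a, u a * star (v a) = 0 := by
    have := congrArg star h
    simpa [dotProduct, mul_comm] using this
  simp [hK, ← Finset.mul_sum]
  right
  simpa using h'

/-- Multiplying columns (j, y) and (j', y') of V by signs keeps it unitary, so the pairing keeps the
value c. As y ≠ y', the first sign affects only terms with r.1 = j and the second only terms with
s.1 = j'. -/
theorem sum_reduce_column_eq_zero [Fintype i] [DecidableEq i] [Fintype o] [DecidableEq o]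
    [Fintype ι] [DecidableEq ι] [Fintype κ] [DecidableEq κ] {K : i × o → i × o → ℂ} {c : ℂ}
    {y y' : ι} (hy : y ≠ y')
    (h : ∀ V : Matrix (o × κ) (i × ι) ℂ, IsUnitary V →
      ∑ r, ∑ s, K r s * reduce (choiProj V) y y' r s = c)
    {V : Matrix (o × κ) (i × ι) ℂ} (hV : IsUnitary V) (j j' : i) :
    ∑ a, ∑ b, K (j, a) (j', b) * reduce (choiProj V) y y' (j, a) (j', b) = 0 := by
  let sg : ℂ → ℂ → i × ι → ℂ := fun s s' r =>
    if r = (j, y) then s else if r = (j', y') then s' else 1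
  let W : ℂ → ℂ → Matrix (o × κ) (i × ι) ℂ := fun s s' => V * Matrix.diagonal (sg s s')
  have hW : ∀ s s' : ℂ, star s * s = 1 → star s' * s' = 1 → IsUnitary (W s s') := by
    intro s s' hs hs'
    have h1 : ∀ r, star (sg s s' r) * sg s s' r = 1 := by
      intro r
      simp only [sg]
      split_ifs <;> simp_all
    have hD : (Matrix.diagonal (sg s s'))ᴴ * Matrix.diagonal (sg s s') = 1 := by
      rw [Matrix.diagonal_conjTranspose, Matrix.diagonal_mul_diagonal, ← Matrix.diagonal_one]
      congr 1
      ext r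
      exact h1 r
    refine isUnitary_of_isometry ?_ hV.card_eq
    simp only [W]
    rw [Matrix.conjTranspose_mul, Matrix.mul_assoc, ← Matrix.mul_assoc Vᴴ, hV.1, Matrix.one_mul, hD]
  have hred : ∀ s s' r r', reduce (choiProj (W s s')) y y' r r' =
      ((if r.1 = j then s else 1) * star (if r'.1 = j' then s' else 1)) *
        reduce (choiProj V) y y' r r' := by
    intro s s' r r'
    simp only [reduce, choiProj_apply, Matrix.of_apply, W, Matrix.mul_diagonal, sg, Prod.mk.injEq,
      hy, hy.symm, and_false, and_true, if_false, Finset.mul_sum, star_mul]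
    exact Finset.sum_congr rfl fun x _ => by ring
  have key : ∀ s s' : ℂ, star s * s = 1 → star s' * s' = 1 →
      ∑ r, ∑ r', K r r' * (((if r.1 = j then s else 1) * star (if r'.1 = j' then s' else 1)) *
        reduce (choiProj V) y y' r r') = c := by
    intro s s' hs hs'
    rw [← h _ (hW s s' hs hs')]
    simp only [hred]
  have h4 : ∑ r, ∑ r', (if r.1 = j then if r'.1 = j' then
      K r r' * reduce (choiProj V) y y' r r' else 0 else 0) = 0 := by
    -- The alternating sum over the four sign choices counts the terms at (j, j') four times and
    -- cancels all others; on the other side it gives c - c - c + c = 0.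
    have e1 := key 1 1 (by simp) (by simp)
    have e2 := key (-1) 1 (by simp) (by simp)
    have e3 := key 1 (-1) (by simp) (by simp)
    have e4 := key (-1) (-1) (by simp) (by simp)
    have e5 : ∑ r, ∑ r', 4 * (if r.1 = j then if r'.1 = j' then
      K r r' * reduce (choiProj V) y y' r r' else 0 else 0) = c - c - c + c := by
      nth_rewrite 1 [← e1]
      nth_rewrite 1 [← e2]
      nth_rewrite 1 [← e3]
      nth_rewrite 1 [← e4]
      simp only [← Finset.sum_sub_distrib, ← Finset.sum_add_distrib]
      refine Finset.sum_congr rfl fun r _ => Finset.sum_congr rfl fun r' _ => ?_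
      split_ifs <;> (simp; try ring)
    simp only [← Finset.mul_sum] at e5
    linear_combination (1 / 4) * e5
  refine Eq.trans ?_ h4
  symm
  rw [Fintype.sum_prod_type, Finset.sum_eq_single j (fun b _ hb => by simp [hb]) (by simp)]
  refine Finset.sum_congr rfl fun a _ => ?_
  rw [Fintype.sum_prod_type, Finset.sum_eq_single j' (fun b _ hb => by simp [hb]) (by simp)]
  simp

theorem exists_unitary_columns [Fintype i] [DecidableEq i] [Fintype o] [DecidableEq o]
    (hc : Fintype.card o = Fintype.card i) {j j' : i} (hj : j ≠ j') {u v : o → ℂ}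
    (hu : star u ⬝ᵥ u = 1) (hv : star v ⬝ᵥ v = 1) (huv : star u ⬝ᵥ v = 0) :
    ∃ V : Matrix o i ℂ, IsUnitary V ∧ (∀ a, V a j = u a) ∧ ∀ a, V a j' = v a := by
  let w : i → EuclideanSpace ℂ o := fun k =>
    if k = j then WithLp.toLp 2 u else WithLp.toLp 2 v
  have hvu : star v ⬝ᵥ u = 0 := by
    rw [Matrix.star_dotProduct, huv, star_zero]
  have hw : Orthonormal ℂ (({j, j'} : Set i).domRestrict w) := by
    rw [orthonormal_iff_ite]
    rintro ⟨k, hk⟩ ⟨l, hl⟩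
    have hj' := hj.symm
    simp only [Set.mem_insert_iff, Set.mem_singleton_iff] at hk hl
    rw [EuclideanSpace.inner_eq_star_dotProduct, dotProduct_comm]
    rcases hk with rfl | rfl <;> rcases hl with rfl | rfl <;> simp_all [w]
  obtain ⟨b, hb⟩ := hw.exists_orthonormalBasis_extension_of_card_eq (by simp [hc])
  refine ⟨Matrix.of fun a k => b k a, isUnitary_of_isometry ?_ hc, fun a => ?_, fun a => ?_⟩
  · ext k l
    have := orthonormal_iff_ite.1 b.orthonormal k l
    rw [EuclideanSpace.inner_eq_star_dotProduct] at this
    rw [Matrix.one_apply, ← this]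
    simp [Matrix.mul_apply, dotProduct, mul_comm]
  · simp [hb j (by simp), w]
  · simp [hb j' (by simp), w, hj.symm]

/-- Columns (j, y) and (j', y') can be prescribed as u ⊗ |x⟩ and v ⊗ |x⟩ for any orthonormal u, v;
they are distinct columns even when j = j', because y ≠ y'. Isolating them leaves the form K (j, ·)
(j', ·) evaluated at (u, v). -/
theorem exists_eq_ite_of_unitary [Fintype i] [DecidableEq i] [Fintype o] [DecidableEq o]
    [Fintype ι] [DecidableEq ι] [Fintype κ] [DecidableEq κ] {K : i × o → i × o → ℂ} {c : ℂ}
    {y y' : ι} (hy : y ≠ y') (x : κ)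
    (hc : Fintype.card o * Fintype.card κ = Fintype.card i * Fintype.card ι)
    (h : ∀ V : Matrix (o × κ) (i × ι) ℂ, IsUnitary V →
      ∑ r, ∑ s, K r s * reduce (choiProj V) y y' r s = c) (j j' : i) :
    ∃ t, ∀ a b, K (j, a) (j', b) = if a = b then t else 0 := by
  refine exists_eq_ite_of_orthonormal (K := fun a b => K (j, a) (j', b)) fun u v hu hv huv => ?_
  have hdot : ∀ u v : o → ℂ, star (fun r : o × κ => u r.1 * if r.2 = x then 1 else 0) ⬝ᵥ
      (fun r : o × κ => v r.1 * if r.2 = x then 1 else 0) = star u ⬝ᵥ v := by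
    intro u v
    simp [dotProduct, Fintype.sum_prod_type]
  obtain ⟨V, hV, h1, h2⟩ := exists_unitary_columns (i := i × ι) (o := o × κ) (j := (j, y))
    (j' := (j', y')) (by simpa using hc) (by simp [hy])
    ((hdot u u).trans hu) ((hdot v v).trans hv) ((hdot u v).trans huv)
  rw [← sum_reduce_column_eq_zero hy h hV j j']
  refine Finset.sum_congr rfl fun a _ => Finset.sum_congr rfl fun b _ => ?_
  congr 1
  simp [reduce, choiProj_apply, h1, h2]

end Scalar

/-! ### The Gram operator of `U` and the trace of a filled superchannel. -/

section TwoSlot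

variable {p aI aO bI bO f : Type*}

/-- The blocks of `Tr_f |U⟩⟩⟨⟨U|` with respect to `p`, with the remaining systems grouped by
slot. -/
def gram [Fintype f] (U : Matrix (aI × bI × f) (p × aO × bO) ℂ) (q q' : p) :
    Matrix ((aI × aO) × (bI × bO)) ((aI × aO) × (bI × bO)) ℂ :=
  Matrix.of fun k l => ∑ c, U (k.1.1, k.2.1, c) (q, k.1.2, k.2.2) *
    star (U (l.1.1, l.2.1, c) (q', l.1.2, l.2.2))

theorem plugTwo_trace [Fintype f] [Fintype aI] [Fintype aO] [Fintype bI] [Fintype bO]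
    {ι κ ι' κ' : Type*} [Fintype κ] [Fintype κ'] (U : Matrix (aI × bI × f) (p × aO × bO) ℂ)
    (E : Matrix ((aI × ι) × (aO × κ)) ((aI × ι) × (aO × κ)) ℂ)
    (E' : Matrix ((bI × ι') × (bO × κ')) ((bI × ι') × (bO × κ')) ℂ) (q q' : p) (y z : ι)
    (y' z' : ι') :
    ∑ r : f × κ × κ', plugTwo (choiProj U) E E' ((q, y, y'), r) ((q', z, z'), r) =
      ∑ k, ∑ l, gram U q q' k l * (reduce E y z k.1 l.1 * reduce E' y' z' k.2 l.2) := by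
  simp only [plugTwo, link, Matrix.submatrix_apply, Matrix.of_apply, Matrix.kroneckerMap_apply]
  rw [Finset.sum_comm]
  refine Finset.sum_congr rfl fun k _ => ?_
  rw [Finset.sum_comm]
  refine Finset.sum_congr rfl fun l _ => ?_
  simp only [gram, reduce, Matrix.of_apply, choiProj_apply, Fintype.sum_prod_type]
  rw [Finset.sum_mul]
  refine Finset.sum_congr rfl fun c _ => ?_
  rw [Finset.sum_mul_sum, Finset.mul_sum]
  refine Finset.sum_congr rfl fun x _ => ?_
  rw [Finset.mul_sum]

theorem sum_gram [Fintype f] [Fintype aI] [Fintype bI] [DecidableEq p]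
    [DecidableEq aO] [DecidableEq bO] {U : Matrix (aI × bI × f) (p × aO × bO) ℂ}
    (hU : Uᴴ * U = 1) (q q' : p) (a : aO) (b : bO) :
    ∑ j, ∑ k, gram U q q' ((j, a), (k, b)) ((j, a), (k, b)) = if q = q' then 1 else 0 := by
  have h := congrFun (congrFun hU (q', a, b)) (q, a, b)
  simp only [Matrix.mul_apply, Fintype.sum_prod_type, Matrix.one_apply, Prod.mk.injEq, and_true,
    Matrix.conjTranspose_apply] at h
  simp only [gram, Matrix.of_apply]
  simp only [eq_comm (a := q), ← h, mul_comm]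

/-- The coordinate form of the orthogonality conditions: up to terms that are trivial on `aO` or on
`bO`, the blocks of `Tr_f |U⟩⟩⟨⟨U|` vanish, and tracing out the input of one slot as well leaves an
operator that is trivial on the output of the other slot. -/
structure GramConditions [Fintype f] [Fintype aI] [Fintype bI] [DecidableEq aO] [DecidableEq bO]
    (U : Matrix (aI × bI × f) (p × aO × bO) ℂ) : Prop where
  both : ∀ q q' j j' k k', ∃ (s : bO → bO → ℂ) (t : aO → aO → ℂ), ∀ a a' b b',
    gram U q q' ((j, a), (k, b)) ((j', a'), (k', b')) =
      (if a = a' then s b b' else 0) + (if b = b' then t a a' else 0)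
  right : ∀ q q' k k' a a', ∃ t : ℂ, ∀ b b',
    ∑ j, gram U q q' ((j, a), (k, b)) ((j, a'), (k', b')) = if b = b' then t else 0
  left : ∀ q q' j j' b b', ∃ t : ℂ, ∀ a a',
    ∑ k, gram U q q' ((j, a), (k, b)) ((j', a'), (k, b')) = if a = a' then t else 0

/-- Inclusion-exclusion form of `both`: the two unknown functions are replaced by values of `gram`
at reference outputs a₀, b₀. -/
theorem GramConditions.both_eq [Fintype f] [Fintype aI] [Fintype bI] [DecidableEq aO]
    [DecidableEq bO] {U : Matrix (aI × bI × f) (p × aO × bO) ℂ} (h : GramConditions U)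
    (a₀ : aO) (b₀ : bO) (q q' : p) (r s : aI × aO) (u v : bI × bO) :
    gram U q q' (r, u) (s, v) =
      (if r.2 = s.2 then gram U q q' ((r.1, a₀), u) ((s.1, a₀), v) else 0) +
      (if u.2 = v.2 then gram U q q' (r, (u.1, b₀)) (s, (v.1, b₀)) else 0) -
      (if r.2 = s.2 then (if u.2 = v.2 then
        gram U q q' ((r.1, a₀), (u.1, b₀)) ((s.1, a₀), (v.1, b₀)) else 0) else 0) := by
  obtain ⟨j, a⟩ := r
  obtain ⟨j', a'⟩ := s
  obtain ⟨k, b⟩ := u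
  obtain ⟨k', b'⟩ := v
  obtain ⟨g, t, hg⟩ := h.both q q' j j' k k'
  simp only [hg]
  split_ifs <;> ring

variable [Fintype p] [DecidableEq p] [Fintype f] [DecidableEq f]
  [Fintype aI] [DecidableEq aI] [Fintype aO] [DecidableEq aO]
  [Fintype bI] [DecidableEq bI] [Fintype bO] [DecidableEq bO]

theorem sum_slots_comm {A B : Type*} [Fintype A] [Fintype B] (T : A × B → A × B → ℂ)
    (e : Matrix A A ℂ) (e' : Matrix B B ℂ) :
    ∑ k, ∑ l, T k l * (e k.1 l.1 * e' k.2 l.2) =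
      ∑ u, ∑ v, (∑ r, ∑ s, T (r, u) (s, v) * e r s) * e' u v := by
  simp only [Fintype.sum_prod_type, Finset.sum_mul]
  rw [Finset.sum_comm]
  refine Finset.sum_congr rfl fun u _ => ?_
  refine (Finset.sum_congr rfl fun r _ => Finset.sum_comm).trans ?_
  rw [Finset.sum_comm]
  refine Finset.sum_congr rfl fun v _ => Finset.sum_congr rfl fun r _ =>
    Finset.sum_congr rfl fun s _ => ?_
  ring

theorem sum_slots_comm' {A B : Type*} [Fintype A] [Fintype B] (T : A × B → A × B → ℂ)
    (e : Matrix A A ℂ) (e' : Matrix B B ℂ) :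
    ∑ k, ∑ l, T k l * (e k.1 l.1 * e' k.2 l.2) =
      ∑ r, ∑ s, (∑ u, ∑ v, T (r, u) (s, v) * e' u v) * e r s := by
  simp only [Fintype.sum_prod_type, Finset.sum_mul]
  refine Finset.sum_congr rfl fun r _ => ?_
  rw [Finset.sum_comm]
  refine Finset.sum_congr rfl fun s _ => Finset.sum_congr rfl fun u _ =>
    Finset.sum_congr rfl fun v _ => ?_
  ring

/-- In the splitting T₁ + T₂ - T₃ of `both_eq`, each term is trivial on one output, so that slot
collapses to a trace over its input. The rest is then trivial on the other output, by `right`, by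
`left`, or by construction, and collapses too. Each term becomes the full trace computed in
`sum_gram`. -/
theorem GramConditions.sum_gram_mul [Nonempty aO] [Nonempty bO]
    {U : Matrix (aI × bI × f) (p × aO × bO) ℂ} (h : GramConditions U) (hU : Uᴴ * U = 1)
    {e : Matrix (aI × aO) (aI × aO) ℂ} {e' : Matrix (bI × bO) (bI × bO) ℂ} {c c' : ℂ}
    (he : ∀ j j', ∑ a, e (j, a) (j', a) = if j = j' then c else 0)
    (he' : ∀ k k', ∑ b, e' (k, b) (k', b) = if k = k' then c' else 0) (q q' : p) :
    ∑ k, ∑ l, gram U q q' k l * (e k.1 l.1 * e' k.2 l.2) =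
      if q = q' then c * c' else 0 := by
  obtain ⟨a₀⟩ := ‹Nonempty aO›
  obtain ⟨b₀⟩ := ‹Nonempty bO›
  let T₁ : (aI × aO) × (bI × bO) → (aI × aO) × (bI × bO) → ℂ := fun k l =>
    if k.1.2 = l.1.2 then gram U q q' ((k.1.1, a₀), k.2) ((l.1.1, a₀), l.2) else 0
  let T₂ : (aI × aO) × (bI × bO) → (aI × aO) × (bI × bO) → ℂ := fun k l =>
    if k.2.2 = l.2.2 then gram U q q' (k.1, (k.2.1, b₀)) (l.1, (l.2.1, b₀)) else 0
  let T₃ : (aI × aO) × (bI × bO) → (aI × aO) × (bI × bO) → ℂ := fun k l =>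
    if k.1.2 = l.1.2 then (if k.2.2 = l.2.2 then
      gram U q q' ((k.1.1, a₀), (k.2.1, b₀)) ((l.1.1, a₀), (l.2.1, b₀)) else 0) else 0
  have hT : ∀ k l, gram U q q' k l = T₁ k l + T₂ k l - T₃ k l := fun k l =>
    h.both_eq a₀ b₀ q q' k.1 l.1 k.2 l.2
  have hright : ∀ a a' k b k' b', ∑ j, gram U q q' ((j, a), (k, b)) ((j, a'), (k', b')) =
      if b = b' then ∑ j, gram U q q' ((j, a), (k, b₀)) ((j, a'), (k', b₀)) else 0 := by
    intro a a' k b k' b'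
    obtain ⟨t, ht⟩ := h.right q q' k k' a a'
    simp [ht]
  have hleft : ∀ b b' j a j' a', ∑ k, gram U q q' ((j, a), (k, b)) ((j', a'), (k, b')) =
      if a = a' then ∑ k, gram U q q' ((j, a₀), (k, b)) ((j', a₀), (k, b')) else 0 := by
    intro b b' j a j' a'
    obtain ⟨t, ht⟩ := h.left q q' j j' b b'
    simp [ht]
  have h₁ : ∑ k, ∑ l, T₁ k l * (e k.1 l.1 * e' k.2 l.2) = if q = q' then c * c' else 0 := by
    rw [sum_slots_comm]
    have : ∀ u v, ∑ r, ∑ s, T₁ (r, u) (s, v) * e r s =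
        c * ∑ j, gram U q q' ((j, a₀), u) ((j, a₀), v) := fun u v =>
      sum_mul_eq_of_diagonal (K := fun r s => T₁ (r, u) (s, v))
        (K' := fun j j' => gram U q q' ((j, a₀), u) ((j', a₀), v)) (fun _ _ _ _ => rfl) he
    simp only [this, mul_assoc, ← Finset.mul_sum]
    rw [sum_mul_eq_of_diagonal
      (K := fun u v => ∑ j, gram U q q' ((j, a₀), u) ((j, a₀), v))
      (fun k k' b b' => hright a₀ a₀ k b k' b') he', Finset.sum_comm, sum_gram hU]
    simp
  have h₂ : ∑ k, ∑ l, T₂ k l * (e k.1 l.1 * e' k.2 l.2) = if q = q' then c * c' else 0 := by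
    rw [sum_slots_comm']
    have : ∀ r s, ∑ u, ∑ v, T₂ (r, u) (s, v) * e' u v =
        c' * ∑ k, gram U q q' (r, (k, b₀)) (s, (k, b₀)) := fun r s =>
      sum_mul_eq_of_diagonal (K := fun u v => T₂ (r, u) (s, v))
        (K' := fun k k' => gram U q q' (r, (k, b₀)) (s, (k', b₀))) (fun _ _ _ _ => rfl) he'
    simp only [this, mul_assoc, ← Finset.mul_sum]
    rw [sum_mul_eq_of_diagonal
      (K := fun r s => ∑ k, gram U q q' (r, (k, b₀)) (s, (k, b₀)))
      (fun j j' a a' => hleft b₀ b₀ j a j' a') he, sum_gram hU]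
    simp [mul_comm]
  have h₃ : ∑ k, ∑ l, T₃ k l * (e k.1 l.1 * e' k.2 l.2) = if q = q' then c * c' else 0 := by
    rw [sum_slots_comm]
    have : ∀ u v, ∑ r, ∑ s, T₃ (r, u) (s, v) * e r s = c * if u.2 = v.2 then
        ∑ j, gram U q q' ((j, a₀), (u.1, b₀)) ((j, a₀), (v.1, b₀)) else 0 := by
      intro u v
      rw [sum_mul_eq_of_diagonal (K := fun r s => T₃ (r, u) (s, v))
        (K' := fun j j' => if u.2 = v.2 then gram U q q' ((j, a₀), (u.1, b₀)) ((j', a₀), (v.1, b₀))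
          else 0) (fun _ _ _ _ => rfl) he]
      split_ifs <;> simp
    simp only [this, mul_assoc, ← Finset.mul_sum]
    rw [sum_mul_eq_of_diagonal (K := fun u v => if u.2 = v.2 then
        ∑ j, gram U q q' ((j, a₀), (u.1, b₀)) ((j, a₀), (v.1, b₀)) else 0)
      (K' := fun k k' => ∑ j, gram U q q' ((j, a₀), (k, b₀)) ((j, a₀), (k', b₀)))
      (fun k k' b b' => rfl) he', Finset.sum_comm, sum_gram hU]
    simp
  simp only [hT, sub_mul, add_mul, Finset.sum_add_distrib, Finset.sum_sub_distrib, h₁, h₂, h₃]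
  ring

end TwoSlot

/-! ### Pure superchannels and the Gram conditions. -/

section PureSuperchannels

variable {p aI aO bI bO f : Type*}
  [Fintype p] [DecidableEq p] [Fintype f] [DecidableEq f]
  [Fintype aI] [DecidableEq aI] [Fintype aO] [DecidableEq aO]
  [Fintype bI] [DecidableEq bI] [Fintype bO] [DecidableEq bO]

/-- The operator obtained by inserting `UA` and `UB` into the slots of `U`. -/
def contract {ι κ ι' κ' : Type*} (U : Matrix (aI × bI × f) (p × aO × bO) ℂ)
    (UA : Matrix (aO × κ) (aI × ι) ℂ) (UB : Matrix (bO × κ') (bI × ι') ℂ) :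
    Matrix (f × κ × κ') (p × ι × ι') ℂ :=
  Matrix.of fun r s => ∑ k : (aI × aO) × (bI × bO), U (k.1.1, k.2.1, r.1) (s.1, k.1.2, k.2.2) *
    (UA (k.1.2, r.2.1) (k.1.1, s.2.1) * UB (k.2.2, r.2.2) (k.2.1, s.2.2))

theorem plugTwo_choiProj {ι κ ι' κ' : Type*} (U : Matrix (aI × bI × f) (p × aO × bO) ℂ)
    (UA : Matrix (aO × κ) (aI × ι) ℂ) (UB : Matrix (bO × κ') (bI × ι') ℂ) :
    plugTwo (choiProj U) (choiProj UA) (choiProj UB) = choiProj (contract U UA UB) := by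
  ext r s
  simp only [plugTwo, link, Matrix.submatrix_apply, Matrix.of_apply, Matrix.kroneckerMap_apply,
    choiProj_apply, contract, star_sum, Finset.sum_mul_sum, star_mul]
  refine Finset.sum_congr rfl fun k _ => Finset.sum_congr rfl fun l _ => ?_
  ring

theorem plugTwo_posSemidef {ι κ ι' κ' : Type*} [Fintype ι] [DecidableEq ι] [Fintype κ]
    [DecidableEq κ] [Fintype ι'] [DecidableEq ι'] [Fintype κ'] [DecidableEq κ']
    {W : Matrix ((p × aO × bO) × (aI × bI × f)) ((p × aO × bO) × (aI × bI × f)) ℂ}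
    {E : Matrix ((aI × ι) × (aO × κ)) ((aI × ι) × (aO × κ)) ℂ}
    {E' : Matrix ((bI × ι') × (bO × κ')) ((bI × ι') × (bO × κ')) ℂ}
    (hW : W.PosSemidef) (hE : E.PosSemidef) (hE' : E'.PosSemidef) :
    (plugTwo W E E').PosSemidef :=
  (link_posSemidef (hW.submatrix _) ((hE.kronecker hE').submatrix _)).submatrix _

theorem GramConditions.plugTwo_trace_eq [Nonempty aO] [Nonempty bO] {ι κ ι' κ' : Type*}
    [Fintype ι] [DecidableEq ι] [Fintype κ]
    [DecidableEq κ] [Fintype ι'] [DecidableEq ι'] [Fintype κ'] [DecidableEq κ']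
    {U : Matrix (aI × bI × f) (p × aO × bO) ℂ}
    (h : GramConditions U) (hU : Uᴴ * U = 1)
    {E : Matrix ((aI × ι) × (aO × κ)) ((aI × ι) × (aO × κ)) ℂ}
    {E' : Matrix ((bI × ι') × (bO × κ')) ((bI × ι') × (bO × κ')) ℂ}
    (hE : ∀ a b, ∑ k, E (a, k) (b, k) = if a = b then 1 else 0)
    (hE' : ∀ a b, ∑ k, E' (a, k) (b, k) = if a = b then 1 else 0) (r s : p × ι × ι') :
    ∑ k, plugTwo (choiProj U) E E' (r, k) (s, k) = if r = s then 1 else 0 := by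
  obtain ⟨q, y, y'⟩ := r
  obtain ⟨q', z, z'⟩ := s
  rw [plugTwo_trace, h.sum_gram_mul hU (reduce_trace hE y z) (reduce_trace hE' y' z')]
  simp only [Prod.mk.injEq]
  split_ifs <;> simp_all

theorem GramConditions.representsPureSuperchannel [Nonempty aI] [Nonempty aO] [Nonempty bI]
    [Nonempty bO] {U : Matrix (aI × bI × f) (p × aO × bO) ℂ} (h : GramConditions U)
    (hU : IsUnitary U) : RepresentsPureSuperchannel U := by
  refine ⟨fun m n m' n' E E' hE hE' => exists_channel_iff.2 ⟨plugTwo_posSemidef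
    (choiProj_posSemidef U) (choi_posSemidef hE.1) (choi_posSemidef hE'.1),
    h.plugTwo_trace_eq hU.1 (choi_trace hE) (choi_trace hE')⟩, fun m n m' n' UA UB hA hB => ?_⟩
  refine ⟨contract U UA UB, isUnitary_of_isometry ?_ ?_, (plugTwo_choiProj U UA UB).symm⟩
  · ext r s
    rw [← choiProj_trace, ← plugTwo_choiProj, h.plugTwo_trace_eq hU.1
      (choiProj_trace_of_isometry hA.1) (choiProj_trace_of_isometry hB.1),
      Matrix.one_apply]
    simp [eq_comm]
  · have h1 := hU.card_eq
    have h2 := hA.card_eq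
    have h3 := hB.card_eq
    simp only [Fintype.card_prod] at h1 h2 h3 ⊢
    -- Unitarity of `U`, `UA`, `UB` fixes the dimensions of the result only up to the common factor
    -- of the four slot dimensions, which can be cancelled because these spaces are nonzero.
    have hpos : 0 < Fintype.card aI * Fintype.card bI * (Fintype.card aO * Fintype.card bO) := by
      have := Fintype.card_pos (α := aI)
      have := Fintype.card_pos (α := aO)
      have := Fintype.card_pos (α := bI)
      have := Fintype.card_pos (α := bO)
      positivity
    apply Nat.eq_of_mul_eq_mul_left hpos
    calc _ = (Fintype.card aI * (Fintype.card bI * Fintype.card f)) *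
          (Fintype.card aO * Fintype.card (Fin n)) * (Fintype.card bO * Fintype.card (Fin n')) := by
          ring
      _ = _ := by rw [h1, h2, h3]; ring

/-- Insertion of unitaries already supplies all the trace identities needed; the ancillas are
reindexed because the definition uses `Fin n`. -/
theorem RepresentsPureSuperchannel.sum_gram_mul {U : Matrix (aI × bI × f) (p × aO × bO) ℂ}
    (h : RepresentsPureSuperchannel U) {ι κ ι' κ' : Type*} [Fintype ι] [DecidableEq ι] [Fintype κ]
    [DecidableEq κ] [Fintype ι'] [DecidableEq ι'] [Fintype κ'] [DecidableEq κ']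
    {UA : Matrix (aO × κ) (aI × ι) ℂ} {UB : Matrix (bO × κ') (bI × ι') ℂ} (hA : IsUnitary UA)
    (hB : IsUnitary UB) (q q' : p) (y z : ι) (y' z' : ι') :
    ∑ k, ∑ l, gram U q q' k l * (reduce (choiProj UA) y z k.1 l.1 *
      reduce (choiProj UB) y' z' k.2 l.2) = if (q, y, y') = (q', z, z') then 1 else 0 := by
  let e := Fintype.equivFin ι
  let e' := Fintype.equivFin ι'
  let d := Fintype.equivFin κ
  let d' := Fintype.equivFin κ'
  obtain ⟨UG, hG, hUG⟩ := h.2 _ _ _ _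
    (UA.submatrix (Prod.map id d.symm) (Prod.map id e.symm))
    (UB.submatrix (Prod.map id d'.symm) (Prod.map id e'.symm))
    (hA.submatrix ((Equiv.refl _).prodCongr d.symm) ((Equiv.refl _).prodCongr e.symm))
    (hB.submatrix ((Equiv.refl _).prodCongr d'.symm) ((Equiv.refl _).prodCongr e'.symm))
  have ht := choiProj_trace UG (q, e y, e' y') (q', e z, e' z')
  rw [hUG, plugTwo_trace, reduce_choiProj_submatrix, reduce_choiProj_submatrix, hG.1,
    Matrix.one_apply] at ht
  simpa [eq_comm] using ht

theorem RepresentsPureSuperchannel.gramConditions [Nonempty aI] [Nonempty aO] [Nonempty bI]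
    [Nonempty bO] {U : Matrix (aI × bI × f) (p × aO × bO) ℂ}
    (h : RepresentsPureSuperchannel U) : GramConditions U := by
  obtain ⟨a₀⟩ := ‹Nonempty aO›
  obtain ⟨b₀⟩ := ‹Nonempty bO›
  obtain ⟨j₀⟩ := ‹Nonempty aI›
  obtain ⟨k₀⟩ := ‹Nonempty bI›
  -- The ancillas aO × Bool at the input and aI × Bool at the output balance the dimensions; the
  -- factor `Bool` provides two distinct input indices even when the output space is
  -- one-dimensional.
  have hA {K : aI × aO → aI × aO → ℂ} := exists_eq_ite_of_unitary (K := K) (c := 0)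
    (y := (a₀, false)) (y' := (a₀, true)) (by simp) (j₀, true) (by simp; ring)
  have hB {K : bI × bO → bI × bO → ℂ} := exists_eq_ite_of_unitary (K := K) (c := 0)
    (y := (b₀, false)) (y' := (b₀, true)) (by simp) (k₀, true) (by simp; ring)
  refine ⟨fun q q' j j' k k' => ?_, fun q q' k k' a a' => ?_, fun q q' j j' b b' => ?_⟩
  -- For each V in slot B, the contraction over B is scalar in (a, a'). Subtracting the reference
  -- value at a₀ when a = a' therefore gives a kernel on B that pairs to zero with every V, hence is
  -- scalar in (b, b').
  · have hd : ∀ a a', ∃ t, ∀ b b', gram U q q' ((j, a), (k, b)) ((j', a'), (k', b')) -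
        (if a = a' then gram U q q' ((j, a₀), (k, b)) ((j', a₀), (k', b')) else 0) =
        if b = b' then t else 0 := by
      intro a a'
      refine hB (K := fun u v => gram U q q' ((j, a), u) ((j', a'), v) -
        (if a = a' then gram U q q' ((j, a₀), u) ((j', a₀), v) else 0)) (fun V hV => ?_) k k'
      obtain ⟨t, ht⟩ := hA (K := fun r s => ∑ u, ∑ v, gram U q q' (r, u) (s, v) *
        reduce (choiProj V) (b₀, false) (b₀, true) u v) (fun V' hV' => by
          rw [← sum_slots_comm' (gram U q q'), h.sum_gram_mul hV' hV]
          simp) j j'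
      have h1 := ht a a'
      have h2 := ht a₀ a₀
      rw [if_pos rfl] at h2
      by_cases haa : a = a'
      · simp only [haa, if_true, sub_mul, Finset.sum_sub_distrib] at h1 ⊢
        rw [h1, h2, sub_self]
      · simpa [haa] using h1
    choose t ht using hd
    refine ⟨fun b b' => gram U q q' ((j, a₀), (k, b)) ((j', a₀), (k', b')), t,
      fun a a' b b' => ?_⟩
    rw [← ht a a' b b']
    ring
  -- Filling slot A with the swap realizes the sum over j at prescribed a, a'.
  · refine hB (K := fun u v => ∑ j, gram U q q' ((j, a), u) ((j, a'), v)) (fun V hV => ?_) k k'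
    have := h.sum_gram_mul (exchange_isUnitary (i := aI) (o := aO)) hV q q' a a'
      (b₀, false) (b₀, true)
    rw [sum_slots_comm (gram U q q')] at this
    simpa [reduce_exchange, Fintype.sum_prod_type] using this
  · refine hA (K := fun r s => ∑ k, gram U q q' (r, (k, b)) (s, (k, b'))) (fun V hV => ?_) j j'
    have := h.sum_gram_mul hV (exchange_isUnitary (i := bI) (o := bO)) q q'
      (a₀, false) (a₀, true) b b'
    rw [sum_slots_comm' (gram U q q')] at this
    simpa [reduce_exchange, Fintype.sum_prod_type] using this

end PureSuperchannels

/-! ### The orthogonality conditions in terms of the Gram operator. -/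

section Orthogonality

variable {p aI aO bI bO f : Type*}
  [Fintype p] [DecidableEq p] [Fintype f] [DecidableEq f]
  [Fintype aI] [DecidableEq aI] [Fintype aO] [DecidableEq aO]
  [Fintype bI] [DecidableEq bI] [Fintype bO] [DecidableEq bO]

theorem perp_iff {x : Type*} [Fintype x] {u v : x → ℂ} :
    Perp u v ↔ ∑ k, u k * star (v k) = 0 := by
  rw [Perp, ← star_eq_zero]
  simp [dotProduct, mul_comm]

theorem sum_mul_star_sum {x y c : Type*} [Fintype x] [Fintype y] [Fintype c] (A : x → ℂ)
    (B : y → ℂ) (u : x → c → ℂ) (v : y → c → ℂ) :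
    ∑ r, (∑ k, A k * u k r) * star (∑ l, B l * v l r) =
      ∑ k, ∑ l, A k * star (B l) * ∑ r, u k r * star (v l r) := by
  simp only [star_sum, Finset.sum_mul_sum]
  rw [Finset.sum_comm]
  refine Finset.sum_congr rfl fun k _ => ?_
  rw [Finset.sum_comm]
  refine Finset.sum_congr rfl fun l _ => ?_
  rw [Finset.mul_sum]
  refine Finset.sum_congr rfl fun r _ => ?_
  rw [star_mul]
  ring

/-- The part of `U (|q⟩|α⟩|β⟩)` along `|w⟩` in `aI ⊗ bI`. -/
def column (U : Matrix (aI × bI × f) (p × aO × bO) ℂ) (α : aO → ℂ) (β : bO → ℂ) (q : p)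
    (w : aI × bI) (c : f) : ℂ :=
  ∑ v : aO × bO, α v.1 * β v.2 * U (w.1, w.2, c) (q, v.1, v.2)

/-- Inner products of the vectors `column U α β q w`. -/
def slotForm (U : Matrix (aI × bI × f) (p × aO × bO) ℂ) (q q' : p) (w w' : aI × bI)
    (α α' : aO → ℂ) (β β' : bO → ℂ) : ℂ :=
  ∑ v : aO × bO, ∑ v' : aO × bO, α v.1 * β v.2 * star (α' v'.1 * β' v'.2) *
    gram U q q' ((w.1, v.1), (w.2, v.2)) ((w'.1, v'.1), (w'.2, v'.2))

theorem sum_column_mul_star (U : Matrix (aI × bI × f) (p × aO × bO) ℂ) (q q' : p)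
    (w w' : aI × bI) (α α' : aO → ℂ) (β β' : bO → ℂ) :
    ∑ c, column U α β q w c * star (column U α' β' q' w' c) =
      slotForm U q q' w w' α α' β β' :=
  sum_mul_star_sum _ _ _ _

theorem mulVec_ket (U : Matrix (aI × bI × f) (p × aO × bO) ℂ) (π : p → ℂ) (α : aO → ℂ)
    (β : bO → ℂ) (j : aI) (k : bI) (c : f) :
    (U *ᵥ ket π α β) (j, k, c) = ∑ q, π q * column U α β q (j, k) c := by
  simp only [Matrix.mulVec, dotProduct, ket, Fintype.sum_prod_type, column, Finset.mul_sum]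
  refine Finset.sum_congr rfl fun q _ => Finset.sum_congr rfl fun a _ =>
    Finset.sum_congr rfl fun b _ => ?_
  ring

theorem braAB_inner (U : Matrix (aI × bI × f) (p × aO × bO) ℂ) (π π' : p → ℂ) (α α' : aO → ℂ)
    (β β' : bO → ℂ) (Γ Γ' : aI × bI → ℂ) :
    ∑ c, braAB Γ (U *ᵥ ket π α β) c * star (braAB Γ' (U *ᵥ ket π' α' β') c) =
      ∑ k : (aI × bI) × p, ∑ l : (aI × bI) × p, star (Γ k.1) * π k.2 *
        star (star (Γ' l.1) * π' l.2) * slotForm U k.2 l.2 k.1 l.1 α α' β β' := by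
  have h : ∀ (Γ : aI × bI → ℂ) (π : p → ℂ) (α : aO → ℂ) (β : bO → ℂ) (c : f),
      braAB Γ (U *ᵥ ket π α β) c =
        ∑ k : (aI × bI) × p, star (Γ k.1) * π k.2 * column U α β k.2 k.1 c := by
    intro Γ π α β c
    simp [braAB, mulVec_ket, Fintype.sum_prod_type, Finset.mul_sum, mul_assoc]
  simp only [h, ← sum_column_mul_star]
  exact sum_mul_star_sum _ _ _ _

/-- A bra over bI alone leaves aI in the inner product, which produces the sum over j and so matches
the condition `right`. -/
theorem braB_inner (U : Matrix (aI × bI × f) (p × aO × bO) ℂ) (π π' : p → ℂ) (α α' : aO → ℂ)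
    (β β' : bO → ℂ) (ψ ψ' : bI → ℂ) :
    ∑ c, braB ψ (U *ᵥ ket π α β) c * star (braB ψ' (U *ᵥ ket π' α' β') c) =
      ∑ k : bI × p, ∑ l : bI × p, star (ψ k.1) * π k.2 *
        star (star (ψ' l.1) * π' l.2) * ∑ j, slotForm U k.2 l.2 (j, k.1) (j, l.1) α α' β β' := by
  have h : ∀ (ψ : bI → ℂ) (π : p → ℂ) (α : aO → ℂ) (β : bO → ℂ) (c : aI × f),
      braB ψ (U *ᵥ ket π α β) c =
        ∑ k : bI × p, star (ψ k.1) * π k.2 * column U α β k.2 (c.1, k.1) c.2 := by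
    intro ψ π α β c
    simp [braB, mulVec_ket, Fintype.sum_prod_type, Finset.mul_sum, mul_assoc]
  simp only [h, ← sum_column_mul_star]
  rw [sum_mul_star_sum]
  simp only [Fintype.sum_prod_type]

theorem braA_inner (U : Matrix (aI × bI × f) (p × aO × bO) ℂ) (π π' : p → ℂ) (α α' : aO → ℂ)
    (β β' : bO → ℂ) (φ φ' : aI → ℂ) :
    ∑ c, braA φ (U *ᵥ ket π α β) c * star (braA φ' (U *ᵥ ket π' α' β') c) =
      ∑ k : aI × p, ∑ l : aI × p, star (φ k.1) * π k.2 *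
        star (star (φ' l.1) * π' l.2) * ∑ j, slotForm U k.2 l.2 (k.1, j) (l.1, j) α α' β β' := by
  have h : ∀ (φ : aI → ℂ) (π : p → ℂ) (α : aO → ℂ) (β : bO → ℂ) (c : bI × f),
      braA φ (U *ᵥ ket π α β) c =
        ∑ k : aI × p, star (φ k.1) * π k.2 * column U α β k.2 (k.1, c.1) c.2 := by
    rintro φ π α β ⟨k, c⟩
    simp [braA, mulVec_ket, Fintype.sum_prod_type, Finset.mul_sum, mul_assoc]
  simp only [h, ← sum_column_mul_star]
  rw [sum_mul_star_sum]
  simp only [Fintype.sum_prod_type]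

/-- Grouping the sums over aO innermost exposes a form in α, α' to which the scalar criterion on A
applies; `slotForm_eq_right` does the same for B. -/
theorem slotForm_eq_left (U : Matrix (aI × bI × f) (p × aO × bO) ℂ) (q q' : p)
    (w w' : aI × bI) (α α' : aO → ℂ) (β β' : bO → ℂ) :
    slotForm U q q' w w' α α' β β' = ∑ b, ∑ b', β b * star (β' b') *
      ∑ a, ∑ a', gram U q q' ((w.1, a), (w.2, b)) ((w'.1, a'), (w'.2, b')) *
        (α a * star (α' a')) := by
  simp only [slotForm, Fintype.sum_prod_type, Finset.mul_sum]
  rw [Finset.sum_comm]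
  refine Finset.sum_congr rfl fun b _ => ?_
  refine (Finset.sum_congr rfl fun a _ => Finset.sum_comm).trans ?_
  rw [Finset.sum_comm]
  refine Finset.sum_congr rfl fun b' _ => Finset.sum_congr rfl fun a _ =>
    Finset.sum_congr rfl fun a' _ => ?_
  rw [star_mul]
  ring

theorem slotForm_eq_right (U : Matrix (aI × bI × f) (p × aO × bO) ℂ) (q q' : p)
    (w w' : aI × bI) (α α' : aO → ℂ) (β β' : bO → ℂ) :
    slotForm U q q' w w' α α' β β' = ∑ a, ∑ a', α a * star (α' a') *
      ∑ b, ∑ b', gram U q q' ((w.1, a), (w.2, b)) ((w'.1, a'), (w'.2, b')) *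
        (β b * star (β' b')) := by
  simp only [slotForm, Fintype.sum_prod_type, Finset.mul_sum]
  refine Finset.sum_congr rfl fun a _ => ?_
  rw [Finset.sum_comm]
  refine Finset.sum_congr rfl fun a' _ => Finset.sum_congr rfl fun b _ =>
    Finset.sum_congr rfl fun b' _ => ?_
  rw [star_mul]
  ring

theorem sum_bilinear_comm {x y c : Type*} [Fintype x] [Fintype y] [Fintype c] (A : y → y → ℂ)
    (B : x → x → ℂ) (g : c → y → y → x → x → ℂ) :
    ∑ k, ∑ b, ∑ b', A b b' * ∑ a, ∑ a', g k b b' a a' * B a a' =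
      ∑ b, ∑ b', A b b' * ∑ a, ∑ a', (∑ k, g k b b' a a') * B a a' := by
  rw [Finset.sum_comm]
  refine Finset.sum_congr rfl fun b _ => ?_
  rw [Finset.sum_comm]
  refine Finset.sum_congr rfl fun b' _ => ?_
  rw [← Finset.mul_sum, Finset.sum_comm]
  refine congrArg _ (Finset.sum_congr rfl fun a _ => ?_)
  rw [Finset.sum_comm]
  exact Finset.sum_congr rfl fun a' _ => (Finset.sum_mul _ _ _).symm

theorem sum_slotForm_left (U : Matrix (aI × bI × f) (p × aO × bO) ℂ) (q q' : p) (j j' : aI)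
    (α α' : aO → ℂ) (β β' : bO → ℂ) :
    ∑ k, slotForm U q q' (j, k) (j', k) α α' β β' = ∑ b, ∑ b', β b * star (β' b') *
      ∑ a, ∑ a', (∑ k, gram U q q' ((j, a), (k, b)) ((j', a'), (k, b'))) *
        (α a * star (α' a')) := by
  simp only [slotForm_eq_left]
  exact sum_bilinear_comm (fun b b' => β b * star (β' b')) (fun a a' => α a * star (α' a'))
    fun k b b' a a' => gram U q q' ((j, a), (k, b)) ((j', a'), (k, b'))

theorem sum_slotForm_right (U : Matrix (aI × bI × f) (p × aO × bO) ℂ) (q q' : p) (k k' : bI)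
    (α α' : aO → ℂ) (β β' : bO → ℂ) :
    ∑ j, slotForm U q q' (j, k) (j, k') α α' β β' = ∑ a, ∑ a', α a * star (α' a') *
      ∑ b, ∑ b', (∑ j, gram U q q' ((j, a), (k, b)) ((j, a'), (k', b'))) *
        (β b * star (β' b')) := by
  simp only [slotForm_eq_right]
  exact sum_bilinear_comm (fun a a' => α a * star (α' a')) (fun b b' => β b * star (β' b'))
    fun j a a' b b' => gram U q q' ((j, a), (k, b)) ((j, a'), (k', b'))

theorem GramConditions.orthogonalityConditions {U : Matrix (aI × bI × f) (p × aO × bO) ℂ}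
    (h : GramConditions U) : OrthogonalityConditions U := by
  intro π π' α α' αp β β' βp Γ Γ' φ φ' ψ ψ' hα hβ
  refine ⟨?_, ?_, ?_⟩
  · rw [perp_iff, braAB_inner]
    refine Finset.sum_eq_zero fun x _ => Finset.sum_eq_zero fun y _ => ?_
    rw [slotForm_eq_right]
    obtain ⟨s, t, hst⟩ := h.both x.2 y.2 x.1.1 y.1.1 x.1.2 y.1.2
    -- Orthogonality of β and βp removes the part trivial on bO. What remains is trivial on aO and
    -- is removed by the orthogonality of α and αp.
    have h1 : ∀ a a', ∑ b, ∑ b', gram U x.2 y.2 ((x.1.1, a), (x.1.2, b)) ((y.1.1, a'), (y.1.2, b'))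
        * (β b * star (βp b')) =
        if a = a' then ∑ b, ∑ b', s b b' * (β b * star (βp b')) else 0 := by
      intro a a'
      have h2 := sum_eq_zero_of_perp (K := fun b b' => if b = b' then t a a' else 0)
        (fun _ _ => rfl) hβ
      simp only [hst, add_mul, Finset.sum_add_distrib, h2]
      split_ifs <;> simp
    simp only [h1, mul_comm (α _ * _)]
    rw [sum_eq_zero_of_perp (fun _ _ => rfl) hα, mul_zero]
  · rw [perp_iff, braB_inner]
    refine Finset.sum_eq_zero fun x _ => Finset.sum_eq_zero fun y _ => ?_
    rw [sum_slotForm_right, Finset.sum_eq_zero, mul_zero]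
    refine fun a _ => Finset.sum_eq_zero fun a' _ => ?_
    obtain ⟨t, ht⟩ := h.right x.2 y.2 x.1 y.1 a a'
    rw [sum_eq_zero_of_perp ht hβ, mul_zero]
  · rw [perp_iff, braA_inner]
    refine Finset.sum_eq_zero fun x _ => Finset.sum_eq_zero fun y _ => ?_
    rw [sum_slotForm_left, Finset.sum_eq_zero, mul_zero]
    refine fun b _ => Finset.sum_eq_zero fun b' _ => ?_
    obtain ⟨t, ht⟩ := h.left x.2 y.2 x.1 y.1 b b'
    rw [sum_eq_zero_of_perp ht hα, mul_zero]

theorem sum_single_mul {x : Type*} [Fintype x] [DecidableEq x] (k l : x) (g : x → x → ℂ) :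
    ∑ a, ∑ b, (Pi.single k 1 : x → ℂ) a * star ((Pi.single l 1 : x → ℂ) b) * g a b = g k l := by
  rw [Finset.sum_eq_single k (fun a _ ha => by simp [ha]) (by simp),
    Finset.sum_eq_single l (fun a _ ha => by simp [ha]) (by simp)]
  simp

theorem sum_single_single {x : Type*} [Fintype x] [DecidableEq x] (k l : x) (q q' : p)
    (g : x × p → x × p → ℂ) :
    ∑ a : x × p, ∑ b : x × p, star ((Pi.single k 1 : x → ℂ) a.1) * (Pi.single q 1 : p → ℂ) a.2 *
      star (star ((Pi.single l 1 : x → ℂ) b.1) * (Pi.single q' 1 : p → ℂ) b.2) * g a b =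
      g (k, q) (l, q') := by
  have h : ∀ (k : x) (q : p) (a : x × p), star ((Pi.single k 1 : x → ℂ) a.1) *
      (Pi.single q 1 : p → ℂ) a.2 = (Pi.single (k, q) 1 : x × p → ℂ) a := by
    rintro k q ⟨a, b⟩
    by_cases h1 : a = k <;> by_cases h2 : b = q <;> simp [h1, h2]
  simp only [h, sum_single_mul]

theorem gramConditions_of_orthogonalityConditions [Nonempty aO] [Nonempty bO]
    {U : Matrix (aI × bI × f) (p × aO × bO) ℂ}
    (h : OrthogonalityConditions U) : GramConditions U := by
  obtain ⟨a₀⟩ := ‹Nonempty aO›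
  refine ⟨fun q q' j j' k k' => ?_, fun q q' k k' a a' => ?_, fun q q' j j' b b' => ?_⟩
  -- The two-stage argument used for superchannels, with orthonormal pairs in place of inserted
  -- unitaries.
  · have hd : ∀ a a', ∃ t, ∀ b b', gram U q q' ((j, a), (k, b)) ((j', a'), (k', b')) -
        (if a = a' then gram U q q' ((j, a₀), (k, b)) ((j', a₀), (k', b')) else 0) =
        if b = b' then t else 0 := by
      intro a a'
      refine exists_eq_ite_of_orthonormal (K := fun b b' =>
        gram U q q' ((j, a), (k, b)) ((j', a'), (k', b')) -
        (if a = a' then gram U q q' ((j, a₀), (k, b)) ((j', a₀), (k', b')) else 0))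
        fun β βp _ _ hβ => ?_
      obtain ⟨t, ht⟩ := exists_eq_ite_of_orthonormal (K := fun a a' => ∑ b, ∑ b',
        gram U q q' ((j, a), (k, b)) ((j', a'), (k', b')) * (β b * star (βp b')))
        fun α αp _ _ hα => by
          have h1 := (h (Pi.single q 1) (Pi.single q' 1) α 0 αp β 0 βp (Pi.single (j, k) 1)
            (Pi.single (j', k') 1) 0 0 0 0 hα hβ).1
          rw [perp_iff, braAB_inner, sum_single_single, slotForm_eq_right] at h1
          simpa only [mul_comm (α _ * _)] using h1
      have h1 := ht a a'
      have h2 := ht a₀ a₀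
      rw [if_pos rfl] at h2
      by_cases haa : a = a'
      · simp only [haa, if_true, sub_mul, Finset.sum_sub_distrib] at h1 ⊢
        rw [h1, h2, sub_self]
      · simpa [haa] using h1
    choose t ht using hd
    refine ⟨fun b b' => gram U q q' ((j, a₀), (k, b)) ((j', a₀), (k', b')), t,
      fun a a' b b' => ?_⟩
    rw [← ht a a' b b']
    ring
  · refine exists_eq_ite_of_orthonormal fun β βp _ _ hβ => ?_
    have h1 := (h (Pi.single q 1) (Pi.single q' 1) (Pi.single a 1) (Pi.single a' 1) 0 β 0 βp 0 0 0 0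
      (Pi.single k 1) (Pi.single k' 1) (by simp [Perp]) hβ).2.1
    rwa [perp_iff, braB_inner, sum_single_single, sum_slotForm_right, sum_single_mul] at h1
  · refine exists_eq_ite_of_orthonormal fun α αp _ _ hα => ?_
    have h1 := (h (Pi.single q 1) (Pi.single q' 1) α 0 αp (Pi.single b 1) (Pi.single b' 1) 0 0 0
      (Pi.single j 1) (Pi.single j' 1) 0 0 hα (by simp [Perp])).2.2
    rwa [perp_iff, braA_inner, sum_single_single, sum_slotForm_left, sum_single_mul] at h1

end Orthogonality

/-! ### Characterization of one-slot superchannels. -/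

section OneSlot

variable {p aI aO f : Type*}

/-- The blocks of `Tr_f S` with respect to `p`, for an operator `S` on `(p ⊗ aO) ⊗ (aI ⊗ f)`. -/
def slotKernel [Fintype f] (S : Matrix ((p × aO) × (aI × f)) ((p × aO) × (aI × f)) ℂ) (q q' : p)
    (r s : aI × aO) : ℂ :=
  ∑ c, S ((q, r.2), (r.1, c)) ((q', s.2), (s.1, c))

theorem plugOne_trace [Fintype f] [Fintype aI] [Fintype aO] {ι κ : Type*} [Fintype κ]
    (S : Matrix ((p × aO) × (aI × f)) ((p × aO) × (aI × f)) ℂ)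
    (E : Matrix ((aI × ι) × (aO × κ)) ((aI × ι) × (aO × κ)) ℂ) (q q' : p) (y z : ι) :
    ∑ r : f × κ, plugOne S E ((q, y), r) ((q', z), r) =
      ∑ k, ∑ l, slotKernel S q q' k l * reduce E y z k l := by
  simp only [plugOne, link, Matrix.submatrix_apply, Matrix.of_apply]
  rw [Finset.sum_comm]
  refine Finset.sum_congr rfl fun k _ => ?_
  rw [Finset.sum_comm]
  refine Finset.sum_congr rfl fun l _ => ?_
  simp only [slotKernel, reduce, Matrix.of_apply, Fintype.sum_prod_type, Finset.sum_mul_sum]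

theorem sum_ite_mul_eq {i o : Type*} [Fintype i] [Fintype o] [DecidableEq o] (K : i → i → ℂ)
    (e : i × o → i × o → ℂ) :
    ∑ k, ∑ l, (if k.2 = l.2 then K k.1 l.1 else 0) * e k l =
      ∑ j, ∑ j', K j j' * ∑ a, e (j, a) (j', a) := by
  simp only [Fintype.sum_prod_type, ite_mul, zero_mul, Finset.sum_ite_eq, Finset.mem_univ, if_true,
    Finset.mul_sum]
  exact Finset.sum_congr rfl fun j _ => Finset.sum_comm

variable [Fintype p] [DecidableEq p] [Fintype f] [DecidableEq f]
  [Fintype aI] [DecidableEq aI] [Fintype aO] [DecidableEq aO]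

/-- The trace conditions that characterize superchannels with one slot. -/
structure SlotConditions (S : Matrix ((p × aO) × (aI × f)) ((p × aO) × (aI × f)) ℂ) : Prop where
  posSemidef : S.PosSemidef
  output : ∀ q q' j j', ∃ t : ℂ, ∀ a a',
    slotKernel S q q' (j, a) (j', a') = if a = a' then t else 0
  input : ∀ q q' a, ∑ j, slotKernel S q q' (j, a) (j, a) = if q = q' then 1 else 0

theorem SlotConditions.isOneSlotSuperchannel [Nonempty aO]
    {S : Matrix ((p × aO) × (aI × f)) ((p × aO) × (aI × f)) ℂ} (h : SlotConditions S) :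
    IsOneSlotSuperchannel S := by
  obtain ⟨a₀⟩ := ‹Nonempty aO›
  intro m n E hE
  refine exists_channel_iff.2 ⟨(link_posSemidef (h.posSemidef.submatrix _)
    ((choi_posSemidef hE.1).submatrix _)).submatrix _, ?_⟩
  rintro ⟨q, y⟩ ⟨q', z⟩
  have hK : ∀ j j' a a', slotKernel S q q' (j, a) (j', a') =
      if a = a' then slotKernel S q q' (j, a₀) (j', a₀) else 0 := by
    intro j j' a a'
    obtain ⟨t, ht⟩ := h.output q q' j j'
    simp [ht]
  rw [plugOne_trace, sum_mul_eq_of_diagonal hK (reduce_trace (choi_trace hE) y z),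
    h.input q q' a₀]
  simp only [Prod.mk.injEq]
  split_ifs <;> simp_all

theorem IsOneSlotSuperchannel.sum_slotKernel_mul
    {S : Matrix ((p × aO) × (aI × f)) ((p × aO) × (aI × f)) ℂ} (h : IsOneSlotSuperchannel S)
    {ι κ : Type*} [Fintype ι] [DecidableEq ι] [Fintype κ] [DecidableEq κ]
    {V : Matrix (aO × κ) (aI × ι) ℂ} (hV : IsUnitary V) (q q' : p) (y z : ι) :
    ∑ k, ∑ l, slotKernel S q q' k l * reduce (choiProj V) y z k l =
      if (q, y) = (q', z) then 1 else 0 := by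
  let e := Fintype.equivFin ι
  let d := Fintype.equivFin κ
  have hV' : IsUnitary (V.submatrix (Prod.map id d.symm) (Prod.map id e.symm)) :=
    hV.submatrix ((Equiv.refl _).prodCongr d.symm) ((Equiv.refl _).prodCongr e.symm)
  obtain ⟨E, hE, hEV⟩ := exists_channel_choiProj hV'.1
  obtain ⟨G, hG, hGS⟩ := h _ _ E hE
  have ht := choi_trace hG (q, e y) (q', e z)
  rw [hGS, hEV, plugOne_trace, reduce_choiProj_submatrix] at ht
  simpa using ht

/-- Filling the slot with the swap turns both slot systems into external ones, so the resulting Choi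
operator is S itself up to relabelling. -/
theorem IsOneSlotSuperchannel.posSemidef
    {S : Matrix ((p × aO) × (aI × f)) ((p × aO) × (aI × f)) ℂ} (h : IsOneSlotSuperchannel S) :
    S.PosSemidef := by
  let e := Fintype.equivFin aO
  let d := Fintype.equivFin aI
  have hV : IsUnitary ((exchange aI aO).submatrix (Prod.map id d.symm) (Prod.map id e.symm)) :=
    exchange_isUnitary.submatrix ((Equiv.refl _).prodCongr d.symm)
      ((Equiv.refl _).prodCongr e.symm)
  obtain ⟨E, hE, hEV⟩ := exists_channel_choiProj hV.1
  obtain ⟨G, hG, hGS⟩ := h _ _ E hE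
  have hpsd := (choi_posSemidef hG.1).submatrix
    (fun r : (p × aO) × (aI × f) => ((r.1.1, e r.1.2), (r.2.2, d r.2.1)))
  convert hpsd using 1
  rw [hGS, hEV]
  ext ⟨⟨q, a⟩, ⟨j, c⟩⟩ ⟨⟨q', a'⟩, ⟨j', c'⟩⟩
  simp [plugOne, link, choiProj_apply, exchange, Matrix.one_apply, Fintype.sum_prod_type,
    ite_and, apply_ite (starRingEnd ℂ)]

theorem IsOneSlotSuperchannel.slotConditions [Nonempty aI] [Nonempty aO]
    {S : Matrix ((p × aO) × (aI × f)) ((p × aO) × (aI × f)) ℂ} (h : IsOneSlotSuperchannel S) :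
    SlotConditions S := by
  obtain ⟨a₀⟩ := ‹Nonempty aO›
  obtain ⟨j₀⟩ := ‹Nonempty aI›
  refine ⟨h.posSemidef, fun q q' => ?_, fun q q' a => ?_⟩
  · refine exists_eq_ite_of_unitary (c := 0) (y := (a₀, false)) (y' := (a₀, true)) (by simp)
      (j₀, true) (by simp; ring) fun V hV => ?_
    rw [h.sum_slotKernel_mul hV]
    simp
  · have ht := h.sum_slotKernel_mul (exchange_isUnitary (i := aI) (o := aO)) q q' a a
    simpa [reduce_exchange, Fintype.sum_prod_type] using ht

end OneSlot

/-! ### Characterization of combs of order A ≺ B. -/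

section Combs

variable {p aI aO bI bO f : Type*}
  [Fintype p] [DecidableEq p] [Fintype f] [DecidableEq f]
  [Fintype aI] [DecidableEq aI] [Fintype aO] [DecidableEq aO]
  [Fintype bI] [DecidableEq bI] [Fintype bO] [DecidableEq bO]

/-- The coordinate form of the conditions under which `U` represents a comb of order `A ≺ B`. -/
structure CombConditions (U : Matrix (aI × bI × f) (p × aO × bO) ℂ) : Prop where
  right : ∀ q q' j j' k k' a a', ∃ t : ℂ, ∀ b b',
    gram U q q' ((j, a), (k, b)) ((j', a'), (k', b')) = if b = b' then t else 0
  left : ∀ q q' j j' b b', ∃ t : ℂ, ∀ a a',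
    ∑ k, gram U q q' ((j, a), (k, b)) ((j', a'), (k, b')) = if a = a' then t else 0

theorem plugComb_trace {ι κ : Type*} [Fintype κ] (U : Matrix (aI × bI × f) (p × aO × bO) ℂ)
    (S : Matrix (((aI × ι) × bI) × (aO × (bO × κ))) (((aI × ι) × bI) × (aO × (bO × κ))) ℂ)
    (q q' : p) (y y' : ι) :
    ∑ r : f × κ, plugComb (choiProj U) S ((q, y), r) ((q', y'), r) =
      ∑ k, ∑ l, gram U q q' k l * ∑ x, S (((k.1.1, y), k.2.1), (k.1.2, (k.2.2, x)))
        (((l.1.1, y'), l.2.1), (l.1.2, (l.2.2, x))) := by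
  simp only [plugComb, link, Matrix.submatrix_apply, Matrix.of_apply]
  rw [Finset.sum_comm]
  refine Finset.sum_congr rfl fun k _ => ?_
  rw [Finset.sum_comm]
  refine Finset.sum_congr rfl fun l _ => ?_
  simp only [gram, Matrix.of_apply, choiProj_apply, Fintype.sum_prod_type, Finset.sum_mul_sum]

theorem sum_slots_regroup {A B : Type*} [Fintype A] [Fintype B] (T : A × B → A × B → ℂ) :
    ∑ k, ∑ l, T k l = ∑ r, ∑ s, ∑ u, ∑ v, T (r, u) (s, v) := by
  simp only [Fintype.sum_prod_type]
  exact Finset.sum_congr rfl fun r _ => Finset.sum_comm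

/-- The causal order is peeled off from its end. Triviality of `gram` on bO traces out the output of
S, which makes S trivial on bI. This traces `gram` over bI, which makes it trivial on aO. Then S is
traced over aO, leaving the identity on its input, and `sum_gram` finishes. -/
theorem CombConditions.isCombAB [Nonempty aO] [Nonempty bI] [Nonempty bO]
    {U : Matrix (aI × bI × f) (p × aO × bO) ℂ} (h : CombConditions U) (hU : Uᴴ * U = 1) :
    IsCombAB (choiProj U) := by
  obtain ⟨a₀⟩ := ‹Nonempty aO›
  obtain ⟨b₀⟩ := ‹Nonempty bO›
  intro m n S hS
  have hS' := hS.slotConditions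
  obtain ⟨k₀⟩ := ‹Nonempty bI›
  refine exists_channel_iff.2 ⟨(link_posSemidef ((choiProj_posSemidef U).submatrix _)
    (hS'.posSemidef.submatrix _)).submatrix _, ?_⟩
  rintro ⟨q, y⟩ ⟨q', y'⟩
  rw [plugComb_trace, sum_slots_regroup]
  have h1 : ∀ r s u v, gram U q q' (r, u) (s, v) =
      if u.2 = v.2 then gram U q q' (r, (u.1, b₀)) (s, (v.1, b₀)) else 0 := by
    rintro ⟨j, a⟩ ⟨j', a'⟩ ⟨k, b⟩ ⟨k', b'⟩
    obtain ⟨t, ht⟩ := h.right q q' j j' k k' a a'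
    simp [ht]
  have h2 : ∀ r s : aI × aO, ∑ k, gram U q q' (r, (k, b₀)) (s, (k, b₀)) =
      if r.2 = s.2 then ∑ k, gram U q q' ((r.1, a₀), (k, b₀)) ((s.1, a₀), (k, b₀)) else 0 := by
    rintro ⟨j, a⟩ ⟨j', a'⟩
    obtain ⟨t, ht⟩ := h.left q q' j j' b₀ b₀
    simp [ht]
  have h3 : ∀ r s : aI × aO, ∀ k k' : bI, ∑ b, ∑ x, S (((r.1, y), k), (r.2, (b, x)))
      (((s.1, y'), k'), (s.2, (b, x))) =
      if k = k' then slotKernel S (r.1, y) (s.1, y') (r.2, k₀) (s.2, k₀) else 0 := by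
    rintro ⟨j, a⟩ ⟨j', a'⟩ k k'
    obtain ⟨t, ht⟩ := hS'.output (j, y) (j', y') a a'
    rw [ht, if_pos rfl, ← ht k k', slotKernel, Fintype.sum_prod_type]
  have h4 : ∀ r s : aI × aO, ∑ u, ∑ v, gram U q q' (r, u) (s, v) *
      ∑ x, S (((r.1, y), u.1), (r.2, (u.2, x))) (((s.1, y'), v.1), (s.2, (v.2, x))) =
      (if r.2 = s.2 then ∑ k, gram U q q' ((r.1, a₀), (k, b₀)) ((s.1, a₀), (k, b₀)) else 0) *
        slotKernel S (r.1, y) (s.1, y') (r.2, k₀) (s.2, k₀) := by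
    intro r s
    conv_lhs => enter [2, u, 2, v, 1]; rw [h1 r s u v]
    rw [← h2]
    rw [sum_ite_mul_eq (fun k k' => gram U q q' (r, (k, b₀)) (s, (k', b₀)))
      (fun u v => ∑ x, S (((r.1, y), u.1), (r.2, (u.2, x))) (((s.1, y'), v.1), (s.2, (v.2, x))))]
    simp only [h3, mul_ite, mul_zero, Finset.sum_ite_eq, Finset.mem_univ, if_true, Finset.sum_mul]
  simp only [h4]
  rw [sum_ite_mul_eq
    (fun j j' => ∑ k, gram U q q' ((j, a₀), (k, b₀)) ((j', a₀), (k, b₀)))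
    (fun r s => slotKernel S (r.1, y) (s.1, y') (r.2, k₀) (s.2, k₀))]
  simp only [hS'.input]
  by_cases hy : y = y'
  · simp [hy, sum_gram hU]
  · simp [hy]

/-- The composition of `E₁ : aI ⊗ ι → aO ⊗ M` with `E₂ : bI ⊗ M → bO ⊗ κ`. -/
def sequence {ι κ M : Type*} [Fintype M] (E₁ : Matrix (aO × M) (aI × ι) ℂ)
    (E₂ : Matrix (bO × κ) (bI × M) ℂ) : Matrix (aO × (bO × κ)) ((aI × ι) × bI) ℂ :=
  Matrix.of fun r s => ∑ μ, E₂ r.2 (s.2, μ) * E₁ (r.1, μ) s.1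

/-- Two isometries joined by a memory M form a one-slot superchannel; these are the test objects for
deriving conditions on a comb. Tracing the final output removes E₂ and leaves the identity on bI. -/
theorem isOneSlotSuperchannel_sequence [Nonempty bI] {ι κ M : Type*} [Fintype M] [DecidableEq M]
    [Fintype ι] [DecidableEq ι] [Fintype κ] [DecidableEq κ] {E₁ : Matrix (aO × M) (aI × ι) ℂ}
    {E₂ : Matrix (bO × κ) (bI × M) ℂ} (h₁ : E₁ᴴ * E₁ = 1) (h₂ : E₂ᴴ * E₂ = 1) :
    IsOneSlotSuperchannel (choiProj (sequence E₁ E₂)) := by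
  have hK : ∀ (q q' : aI × ι) (r s : aO × bI), slotKernel (choiProj (sequence E₁ E₂)) q q' r s =
      if r.2 = s.2 then ∑ μ, E₁ (r.1, μ) q * star (E₁ (s.1, μ) q') else 0 := by
    intro q q' r s
    simp only [slotKernel, choiProj_apply, sequence, Matrix.of_apply, mul_comm (E₂ _ _)]
    rw [sum_mul_star_sum (fun μ => E₁ (r.1, μ) q) (fun μ => E₁ (s.1, μ) q')
      (fun μ c => E₂ c (r.2, μ)) (fun μ c => E₂ c (s.2, μ))]
    have h3 : ∀ μ ν, ∑ c, E₂ c (r.2, μ) * star (E₂ c (s.2, ν)) =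
        if μ = ν then (if r.2 = s.2 then 1 else 0) else 0 := by
      intro μ ν
      have := congrFun (congrFun h₂ (s.2, ν)) (r.2, μ)
      simp only [Matrix.mul_apply, Matrix.conjTranspose_apply, Matrix.one_apply, Prod.mk.injEq,
        mul_comm (star _)] at this
      rw [this, ← ite_and]
      simp [and_comm, eq_comm]
    simp only [h3]
    split_ifs <;> simp
  refine SlotConditions.isOneSlotSuperchannel ⟨choiProj_posSemidef _, fun q q' a a' =>
    ⟨∑ μ, E₁ (a, μ) q * star (E₁ (a', μ) q'), fun k k' => hK q q' (a, k) (a', k')⟩,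
    fun q q' k => ?_⟩
  simp only [hK, if_true]
  have := congrFun (congrFun h₁ q') q
  simp only [Matrix.mul_apply, Matrix.conjTranspose_apply, Matrix.one_apply,
    Fintype.sum_prod_type, mul_comm (star _)] at this
  rw [this]
  simp [eq_comm]

theorem IsCombAB.sum_gram_mul [Nonempty bI] {U : Matrix (aI × bI × f) (p × aO × bO) ℂ}
    (h : IsCombAB (choiProj U)) {ι κ M : Type*} [Fintype M] [DecidableEq M]
    [Fintype ι] [DecidableEq ι] [Fintype κ] [DecidableEq κ] {E₁ : Matrix (aO × M) (aI × ι) ℂ}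
    {E₂ : Matrix (bO × κ) (bI × M) ℂ} (h₁ : IsUnitary E₁) (h₂ : IsUnitary E₂) (q q' : p)
    (y y' : ι) :
    ∑ k, ∑ l, gram U q q' k l *
      ∑ x, sequence E₁ E₂ (k.1.2, (k.2.2, x)) ((k.1.1, y), k.2.1) *
        star (sequence E₁ E₂ (l.1.2, (l.2.2, x)) ((l.1.1, y'), l.2.1)) =
      if (q, y) = (q', y') then 1 else 0 := by
  let e := Fintype.equivFin ι
  let d := Fintype.equivFin κ
  have h₁' := h₁.submatrix (Equiv.refl _) ((Equiv.refl _).prodCongr e.symm)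
  have h₂' := h₂.submatrix ((Equiv.refl _).prodCongr d.symm) (Equiv.refl _)
  obtain ⟨G, hG, hGS⟩ := h _ _ _ (isOneSlotSuperchannel_sequence h₁'.1 h₂'.1)
  have ht := choi_trace hG (q, e y) (q', e y')
  rw [hGS, plugComb_trace] at ht
  have hx : ∀ k l : (aI × aO) × (bI × bO),
      ∑ x, sequence E₁ E₂ (k.1.2, (k.2.2, x)) ((k.1.1, y), k.2.1) *
        star (sequence E₁ E₂ (l.1.2, (l.2.2, x)) ((l.1.1, y'), l.2.1)) =
      ∑ x, sequence E₁ E₂ (k.1.2, (k.2.2, d.symm x)) ((k.1.1, e.symm (e y)), k.2.1) *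
        star (sequence E₁ E₂ (l.1.2, (l.2.2, d.symm x)) ((l.1.1, e.symm (e y')), l.2.1)) := by
    intro k l
    rw [e.symm_apply_apply, e.symm_apply_apply]
    exact (d.symm.sum_comp (fun x => sequence E₁ E₂ (k.1.2, (k.2.2, x)) ((k.1.1, y), k.2.1) *
        star (sequence E₁ E₂ (l.1.2, (l.2.2, x)) ((l.1.1, y'), l.2.1)))).symm
  simp only [hx]
  refine Eq.trans ?_ (ht.trans (by simp))
  rfl

/-- The unitary `aI ⊗ (o ⊗ κ) → o ⊗ (aI ⊗ κ)` that exchanges `aI` and `o`. -/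
def passThrough (i o κ : Type*) [DecidableEq i] [DecidableEq o] [DecidableEq κ] :
    Matrix (o × (i × κ)) (i × (o × κ)) ℂ :=
  (1 : Matrix (o × (i × κ)) (o × (i × κ)) ℂ).submatrix id fun r => (r.2.1, (r.1, r.2.2))

theorem passThrough_isUnitary {i o κ : Type*} [Fintype i] [Fintype o] [Fintype κ]
    [DecidableEq i] [DecidableEq o] [DecidableEq κ] : IsUnitary (passThrough i o κ) := by
  have h : IsUnitary (1 : Matrix (o × (i × κ)) (o × (i × κ)) ℂ) := by simp [IsUnitary]
  let e : i × (o × κ) ≃ o × (i × κ) := ⟨fun r => (r.2.1, (r.1, r.2.2)),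
    fun r => (r.2.1, (r.1, r.2.2)), fun _ => rfl, fun _ => rfl⟩
  exact h.submatrix (Equiv.refl _) e

theorem sequence_passThrough_left {κ κ' : Type*} [Fintype κ] [DecidableEq κ]
    (V : Matrix (bO × κ') (bI × (aI × κ)) ℂ) (a a' : aO) (j : aI) (c : κ) (k : bI)
    (r : bO × κ') :
    sequence (passThrough aI aO κ) V (a, r) ((j, (a', c)), k) =
      if a = a' then V r (k, (j, c)) else 0 := by
  by_cases haa : a = a' <;> simp [sequence, passThrough, Matrix.one_apply, haa]

theorem sequence_passThrough_right {ι κ : Type*} [Fintype κ] [DecidableEq κ]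
    (V : Matrix (aO × (bO × κ)) (aI × ι) ℂ) (a : aO) (b : bO) (k k' : bI) (c : κ) (r : aI × ι) :
    sequence V (passThrough bI bO κ) (a, (b, (k, c))) (r, k') =
      if k = k' then V (a, (b, c)) r else 0 := by
  have : ∀ μ, passThrough bI bO κ (b, (k, c)) (k', μ) =
      if k = k' then (if (b, c) = μ then 1 else 0) else 0 := by
    rintro ⟨b', c'⟩
    by_cases hk : k = k' <;> simp [passThrough, Matrix.one_apply, hk]
  simp only [sequence, Matrix.of_apply, this]
  split_ifs <;> simp

theorem sum_slots_fix (a : aO) (F : (aI × aO) × (bI × bO) → ℂ) :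
    ∑ k : (aI × aO) × (bI × bO), (if k.1.2 = a then F k else 0) =
      ∑ u : (bI × aI) × bO, F ((u.1.2, a), (u.1.1, u.2)) := by
  simp only [Fintype.sum_prod_type]
  rw [Finset.sum_comm, Finset.sum_eq_single a (fun b _ hb => by simp [hb]) (by simp),
    Finset.sum_comm]
  simp

/-- Slot A is filled by a swap that feeds an ancilla into aO and stores aI in the memory. The second
operation V then acts jointly on bI and aI, so it probes all input indices while a, a' stay fixed.
-/
theorem IsCombAB.sum_gram_mul_reduce_right [Nonempty bI]
    {U : Matrix (aI × bI × f) (p × aO × bO) ℂ} (h : IsCombAB (choiProj U)) {ι κ : Type*}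
    [Fintype ι] [DecidableEq ι] [Fintype κ] [DecidableEq κ]
    {V : Matrix (bO × κ) ((bI × aI) × ι) ℂ} (hV : IsUnitary V) (q q' : p) (a a' : aO)
    {y y' : ι} (hy : y ≠ y') :
    ∑ u : (bI × aI) × bO, ∑ v : (bI × aI) × bO,
      gram U q q' ((u.1.2, a), (u.1.1, u.2)) ((v.1.2, a'), (v.1.1, v.2)) *
        reduce (choiProj V) y y' u v = 0 := by
  have hV' := hV.submatrix (Equiv.refl _) (Equiv.prodAssoc bI aI ι).symm
  have ht := h.sum_gram_mul passThrough_isUnitary hV' q q' (a, y) (a', y')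
  rw [if_neg (by simp [hy])] at ht
  rw [← ht]
  simp only [sequence_passThrough_left]
  rw [← sum_slots_fix a (fun k => ∑ v : (bI × aI) × bO,
      gram U q q' k ((v.1.2, a'), (v.1.1, v.2)) *
        reduce (choiProj V) y y' ((k.2.1, k.1.1), k.2.2) v)]
  refine Finset.sum_congr rfl fun k _ => ?_
  rw [← sum_slots_fix a' (fun l => gram U q q' k l *
        reduce (choiProj V) y y' ((k.2.1, k.1.1), k.2.2) ((l.2.1, l.1.1), l.2.2))]
  by_cases hk : k.1.2 = a
  · rw [if_pos hk]
    refine Finset.sum_congr rfl fun l _ => ?_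
    by_cases hl : l.1.2 = a'
    · simp only [hk, hl, if_true]
      rfl
    · simp [hl]
  · simp [hk]

/-- Here slot B carries the swap: bI is sent to the traced ancilla output and bO is supplied by V
through the memory. Since `gram` is already trivial on bO by `hb`, the factor bO joins the traced
ancilla of V. -/
theorem IsCombAB.sum_gram_mul_reduce_left [Nonempty bI]
    {U : Matrix (aI × bI × f) (p × aO × bO) ℂ} (h : IsCombAB (choiProj U)) {ι κ : Type*}
    [Fintype ι] [DecidableEq ι] [Fintype κ] [DecidableEq κ]
    {V : Matrix (aO × (bO × κ)) (aI × ι) ℂ} (hV : IsUnitary V) (q q' : p) {y y' : ι} (hy : y ≠ y')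
    (b₀ : bO) (hb : ∀ r s u v, gram U q q' (r, u) (s, v) =
      if u.2 = v.2 then gram U q q' (r, (u.1, b₀)) (s, (v.1, b₀)) else 0) :
    ∑ r, ∑ s, (∑ k, gram U q q' (r, (k, b₀)) (s, (k, b₀))) * reduce (choiProj V) y y' r s = 0 := by
  have ht := h.sum_gram_mul hV (passThrough_isUnitary (i := bI) (o := bO) (κ := κ)) q q' y y'
  rw [if_neg (by simp [hy]), sum_slots_regroup] at ht
  rw [← ht]
  refine Finset.sum_congr rfl fun r _ => Finset.sum_congr rfl fun s _ => ?_
  conv_rhs => enter [2, u, 2, v, 1]; rw [hb r s u v]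
  simp only [Fintype.sum_prod_type (α₁ := bI) (α₂ := κ), sequence_passThrough_right]
  rw [sum_ite_mul_eq (fun k k' => gram U q q' (r, (k, b₀)) (s, (k', b₀)))
    (fun u v => ∑ k, ∑ c, (if k = u.1 then V (r.2, (u.2, c)) (r.1, y) else 0) *
      star (if k = v.1 then V (s.2, (v.2, c)) (s.1, y') else 0))]
  have hred : ∀ k k' : bI, ∑ b, ∑ k₁, ∑ c, (if k₁ = k then V (r.2, (b, c)) (r.1, y) else 0) *
      star (if k₁ = k' then V (s.2, (b, c)) (s.1, y') else 0) =
      if k = k' then reduce (choiProj V) y y' r s else 0 := by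
    intro k k'
    simp only [reduce, choiProj_apply, Matrix.of_apply, Fintype.sum_prod_type]
    by_cases hk : k = k'
    · rw [if_pos hk]
      refine Finset.sum_congr rfl fun b _ => ?_
      rw [Finset.sum_eq_single k (fun l _ hl => by simp [hl]) (by simp)]
      simp [hk]
    · rw [if_neg hk]
      refine Finset.sum_eq_zero fun b _ => Finset.sum_eq_zero fun k₁ _ =>
        Finset.sum_eq_zero fun c _ => ?_
      by_cases hk₁ : k₁ = k
      · simp [hk₁, hk]
      · simp [hk₁]
  simp only [hred, mul_ite, mul_zero, Finset.sum_ite_eq, Finset.mem_univ, if_true, Finset.sum_mul]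

theorem IsCombAB.combConditions [Nonempty aI] [Nonempty aO] [Nonempty bI] [Nonempty bO]
    {U : Matrix (aI × bI × f) (p × aO × bO) ℂ} (h : IsCombAB (choiProj U)) :
    CombConditions U := by
  obtain ⟨a₀⟩ := ‹Nonempty aO›
  obtain ⟨b₀⟩ := ‹Nonempty bO›
  obtain ⟨j₀⟩ := ‹Nonempty aI›
  have k₀ := Classical.arbitrary bI
  have hright : ∀ q q' j j' k k' a a', ∃ t : ℂ, ∀ b b',
      gram U q q' ((j, a), (k, b)) ((j', a'), (k', b')) = if b = b' then t else 0 := by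
    intro q q' j j' k k' a a'
    exact exists_eq_ite_of_unitary (K := fun u v : (bI × aI) × bO =>
      gram U q q' ((u.1.2, a), (u.1.1, u.2)) ((v.1.2, a'), (v.1.1, v.2))) (c := 0)
      (κ := (bI × aI) × Bool) (y := (b₀, false))
      (y' := (b₀, true)) (by simp) ((k₀, j₀), true) (by simp; ring)
      (fun V hV => h.sum_gram_mul_reduce_right hV q q' a a' (by simp)) (k, j) (k', j')
  refine ⟨hright, fun q q' j j' b b' => ?_⟩
  by_cases hbb : b = b'
  · subst hbb
    refine exists_eq_ite_of_unitary (K := fun r s : aI × aO =>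
      ∑ k, gram U q q' (r, (k, b)) (s, (k, b))) (c := 0)
      -- The output ancilla must contain bO, since V also prepares the output of slot B; the other
      -- factors balance dimensions and provide two input indices.
      (ι := (aO × bO) × Bool) (κ := bO × (aI × Bool)) (y := ((a₀, b₀), false))
      (y' := ((a₀, b₀), true)) (by simp) (b₀, (j₀, true)) (by simp; ring)
      (fun V hV => h.sum_gram_mul_reduce_left hV q q' (by simp) b ?_) j j'
    rintro ⟨j, a⟩ ⟨j', a'⟩ ⟨k, b₁⟩ ⟨k', b₂⟩
    obtain ⟨t, ht⟩ := hright q q' j j' k k' a a'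
    simp [ht]
  · refine ⟨0, fun a a' => ?_⟩
    rw [ite_self]
    refine Finset.sum_eq_zero fun k _ => ?_
    obtain ⟨t, ht⟩ := hright q q' j j' k k a a'
    rw [ht, if_neg hbb]

end Combs

/-! ### Subspaces, their inclusion matrices and projections. -/

section Inclusion

variable {x y : Type*} [Fintype x] [DecidableEq x]

theorem inclusion_conjTranspose_mul {n m : ℕ} {S T : Submodule ℂ (EuclideanSpace ℂ x)}
    (e : OrthonormalBasis (Fin n) ℂ S) (d : OrthonormalBasis (Fin m) ℂ T) (s : Fin n) (t : Fin m) :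
    ((inclusion e)ᴴ * inclusion d) s t = ⟪(e s : EuclideanSpace ℂ x), d t⟫_ℂ := by
  simp [Matrix.mul_apply, inclusion, EuclideanSpace.inner_eq_star_dotProduct, dotProduct, mul_comm]

theorem inclusion_isometry {n : ℕ} {S : Submodule ℂ (EuclideanSpace ℂ x)}
    (e : OrthonormalBasis (Fin n) ℂ S) : (inclusion e)ᴴ * inclusion e = 1 := by
  ext s t
  rw [inclusion_conjTranspose_mul, ← Submodule.coe_inner, orthonormal_iff_ite.1 e.orthonormal,
    Matrix.one_apply]

theorem inclusion_conjTranspose_mul_eq_zero {n m : ℕ} {S T : Submodule ℂ (EuclideanSpace ℂ x)}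
    (h : S ⟂ T) (e : OrthonormalBasis (Fin n) ℂ S) (d : OrthonormalBasis (Fin m) ℂ T) :
    (inclusion e)ᴴ * inclusion d = 0 := by
  ext s t
  rw [inclusion_conjTranspose_mul]
  exact h.inner_eq (e s).2 (d t).2

theorem inclusion_mul_conjTranspose_mul {n : ℕ} {S : Submodule ℂ (EuclideanSpace ℂ x)}
    (e : OrthonormalBasis (Fin n) ℂ S) {M : Matrix x y ℂ}
    (hM : ∀ t, WithLp.toLp 2 (fun k => M k t) ∈ S) : inclusion e * ((inclusion e)ᴴ * M) = M := by
  ext k t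
  have h := congrArg (fun v : S => (v : EuclideanSpace ℂ x) k) (e.sum_repr' ⟨_, hM t⟩)
  simp only [Submodule.coe_sum, Submodule.coe_smul, WithLp.ofLp_sum, WithLp.ofLp_smul,
    Finset.sum_apply, Pi.smul_apply, smul_eq_mul, Submodule.coe_inner] at h
  rw [← h]
  simp only [Matrix.mul_apply, inclusion, Matrix.of_apply, Matrix.conjTranspose_apply,
    EuclideanSpace.inner_eq_star_dotProduct, dotProduct]
  refine Finset.sum_congr rfl fun s _ => ?_
  rw [mul_comm]
  congr 1
  exact Finset.sum_congr rfl fun l _ => mul_comm _ _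

theorem inclusion_conjTranspose_mul_orthogonal {n : ℕ} {S : Submodule ℂ (EuclideanSpace ℂ x)}
    (e : OrthonormalBasis (Fin n) ℂ Sᗮ) {M : Matrix x y ℂ}
    (hM : ∀ t, WithLp.toLp 2 (fun k => M k t) ∈ S) : (inclusion e)ᴴ * M = 0 := by
  ext s t
  have h := (Submodule.mem_orthogonal' S _).1 (e s).2 _ (hM t)
  rw [EuclideanSpace.inner_eq_star_dotProduct] at h
  simpa [Matrix.mul_apply, inclusion, dotProduct, mul_comm] using h

theorem inclusion_add_orthogonal {n m : ℕ} {S : Submodule ℂ (EuclideanSpace ℂ x)}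
    (e : OrthonormalBasis (Fin n) ℂ S) (d : OrthonormalBasis (Fin m) ℂ Sᗮ) :
    inclusion d * (inclusion d)ᴴ + inclusion e * (inclusion e)ᴴ = 1 := by
  have h : ∀ t, WithLp.toLp 2 (fun k =>
      (1 - inclusion e * (inclusion e)ᴴ : Matrix x x ℂ) k t) ∈ Sᗮ := by
    intro t
    rw [Submodule.mem_orthogonal]
    intro u hu
    have h1 := inclusion_mul_conjTranspose_mul e (M := Matrix.of fun k (_ : Unit) => u k)
      (fun _ => hu)
    have h2 : (Matrix.of fun k (_ : Unit) => u k)ᴴ * (1 - inclusion e * (inclusion e)ᴴ) = 0 := by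
      rw [← Matrix.conjTranspose_inj]
      rw [Matrix.conjTranspose_mul, Matrix.conjTranspose_conjTranspose, Matrix.conjTranspose_sub,
        Matrix.conjTranspose_one, Matrix.conjTranspose_mul, Matrix.conjTranspose_conjTranspose,
        Matrix.sub_mul, Matrix.one_mul, Matrix.mul_assoc, h1, sub_self, Matrix.conjTranspose_zero]
    have h3 := congrFun (congrFun h2 ()) t
    rw [EuclideanSpace.inner_eq_star_dotProduct]
    rw [Matrix.mul_apply] at h3
    simpa [dotProduct, mul_comm] using h3
  have h1 := inclusion_mul_conjTranspose_mul d h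
  rw [Matrix.mul_sub, Matrix.mul_one, ← Matrix.mul_assoc (inclusion d)ᴴ,
    inclusion_conjTranspose_mul_orthogonal d (M := inclusion e) (fun t => (e t).2),
    Matrix.zero_mul, sub_zero] at h1
  rw [h1, sub_add_cancel]

/-- A subspace invariant under M and Mᴴ is reducing, so its projection commutes with M. -/
theorem commute_inclusion {n : ℕ} {S : Submodule ℂ (EuclideanSpace ℂ x)}
    (e : OrthonormalBasis (Fin n) ℂ S) {M : Matrix x x ℂ}
    (hM : ∀ v ∈ S, WithLp.toLp 2 (M *ᵥ v) ∈ S) (hM' : ∀ v ∈ S, WithLp.toLp 2 (Mᴴ *ᵥ v) ∈ S) :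
    M * (inclusion e * (inclusion e)ᴴ) = inclusion e * (inclusion e)ᴴ * M := by
  have h1 := inclusion_mul_conjTranspose_mul e (M := M * inclusion e) fun t => hM _ (e t).2
  have h2 := inclusion_mul_conjTranspose_mul e (M := Mᴴ * inclusion e) fun t => hM' _ (e t).2
  have h3 := congrArg Matrix.conjTranspose h2
  simp only [Matrix.conjTranspose_mul, Matrix.conjTranspose_conjTranspose] at h3
  calc M * (inclusion e * (inclusion e)ᴴ) = M * inclusion e * (inclusion e)ᴴ := by
        rw [Matrix.mul_assoc]
    _ = inclusion e * ((inclusion e)ᴴ * M * inclusion e * (inclusion e)ᴴ) := by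
        rw [← h1]
        simp only [Matrix.mul_assoc]
    _ = inclusion e * (inclusion e)ᴴ * M := by rw [h3, Matrix.mul_assoc]

theorem exists_subspace_of_projection {Q : Matrix x x ℂ} (hQ : Qᴴ = Q) (hQ' : Q * Q = Q) :
    ∃ S : Submodule ℂ (EuclideanSpace ℂ x), ∀ {n : ℕ} (e : OrthonormalBasis (Fin n) ℂ S),
      inclusion e * (inclusion e)ᴴ = Q := by
  refine ⟨LinearMap.range (Matrix.toEuclideanLin Q), fun {n} e => ?_⟩
  have h1 := inclusion_mul_conjTranspose_mul e (M := Q) fun t =>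
    ⟨EuclideanSpace.single t 1, by ext k; simp [Matrix.toEuclideanLin]⟩
  have h2 : Q * inclusion e = inclusion e := by
    ext k t
    obtain ⟨w, hw⟩ := (e t).2
    have : Q *ᵥ (e t : EuclideanSpace ℂ x).ofLp = (e t : EuclideanSpace ℂ x).ofLp := by
      rw [← hw]
      simp [Matrix.toEuclideanLin, hQ']
    exact congrFun this k
  have h3 := congrArg Matrix.conjTranspose h1
  simp only [Matrix.conjTranspose_mul, Matrix.conjTranspose_conjTranspose, hQ] at h3
  refine Eq.trans ?_ h3
  rw [h2]

end Inclusion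

/-! ### Direct sums of combs satisfy the Gram conditions. -/

section DirectSums

variable {p aI aO bI bO f : Type*}
  [Fintype p] [DecidableEq p] [Fintype f] [DecidableEq f]
  [Fintype aI] [DecidableEq aI] [Fintype aO] [DecidableEq aO]
  [Fintype bI] [DecidableEq bI] [Fintype bO] [DecidableEq bO]

/-- The operator `U` with the roles of the slots exchanged. -/
def swapOperator (U : Matrix (aI × bI × f) (p × aO × bO) ℂ) :
    Matrix (bI × aI × f) (p × bO × aO) ℂ :=
  U.submatrix (fun r => (r.2.1, r.1, r.2.2)) (fun r => (r.1, r.2.2, r.2.1))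

/-- Turns the order B ≺ A into the order A ≺ B for `swapOperator U`, so that one characterization of
combs serves both. -/
theorem swapSlots_choiProj (U : Matrix (aI × bI × f) (p × aO × bO) ℂ) :
    swapSlots (choiProj U) = choiProj (swapOperator U) := rfl

theorem gram_swapOperator (U : Matrix (aI × bI × f) (p × aO × bO) ℂ) (q q' : p) (r s : aI × aO)
    (u v : bI × bO) :
    gram (swapOperator U) q q' (u, r) (v, s) = gram U q q' (r, u) (s, v) := rfl

theorem extendByZero_apply {m n : ℕ} {P' : Submodule ℂ (EuclideanSpace ℂ p)}
    {F' : Submodule ℂ (EuclideanSpace ℂ f)} (eP : OrthonormalBasis (Fin m) ℂ P')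
    (eF : OrthonormalBasis (Fin n) ℂ F') (V : Matrix (aI × bI × Fin n) (Fin m × aO × bO) ℂ)
    (j : aI) (k : bI) (c : f) (q : p) (a : aO) (b : bO) :
    extendByZero eP eF V (j, k, c) (q, a, b) = ∑ t, star (inclusion eP q t) *
      ∑ s, inclusion eF c s * V (j, k, s) (t, a, b) := by
  simp [extendByZero, Matrix.mul_apply, Fintype.sum_prod_type, Matrix.one_apply, mul_comm]

theorem sum_inclusion_mul {m n : ℕ} {S T : Submodule ℂ (EuclideanSpace ℂ f)}
    (e : OrthonormalBasis (Fin n) ℂ S) (d : OrthonormalBasis (Fin m) ℂ T) (A : Fin n → ℂ)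
    (B : Fin m → ℂ) :
    ∑ c, (∑ s, inclusion e c s * A s) * star (∑ t, inclusion d c t * B t) =
      ∑ s, ∑ t, A s * star (B t) * ((inclusion d)ᴴ * inclusion e) t s := by
  have h := sum_mul_star_sum A B (fun s c => inclusion e c s) (fun t c => inclusion d c t)
  simp only [mul_comm (A _), mul_comm (B _)] at h
  rw [h]
  simp only [Matrix.mul_apply, Matrix.conjTranspose_apply, mul_comm]

/-- The cross terms between the two summands vanish because F₁ and F₂ are orthogonal and F is traced
out. -/
theorem gram_extendByZero_add {m₁ m₂ n₁ n₂ : ℕ} {P₁ P₂ : Submodule ℂ (EuclideanSpace ℂ p)}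
    {F₁ F₂ : Submodule ℂ (EuclideanSpace ℂ f)} (hF : F₁ ⟂ F₂)
    (eP₁ : OrthonormalBasis (Fin m₁) ℂ P₁) (eP₂ : OrthonormalBasis (Fin m₂) ℂ P₂)
    (eF₁ : OrthonormalBasis (Fin n₁) ℂ F₁) (eF₂ : OrthonormalBasis (Fin n₂) ℂ F₂)
    (U₁ : Matrix (aI × bI × Fin n₁) (Fin m₁ × aO × bO) ℂ)
    (U₂ : Matrix (aI × bI × Fin n₂) (Fin m₂ × aO × bO) ℂ) (q q' : p)
    (k l : (aI × aO) × (bI × bO)) :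
    gram (extendByZero eP₁ eF₁ U₁ + extendByZero eP₂ eF₂ U₂) q q' k l =
      (∑ t, ∑ t', star (inclusion eP₁ q t) * inclusion eP₁ q' t' * gram U₁ t t' k l) +
      ∑ t, ∑ t', star (inclusion eP₂ q t) * inclusion eP₂ q' t' * gram U₂ t t' k l := by
  obtain ⟨⟨j, a⟩, ⟨i, b⟩⟩ := k
  obtain ⟨⟨j', a'⟩, ⟨i', b'⟩⟩ := l
  have h₁ := inclusion_isometry eF₁
  have h₂ := inclusion_isometry eF₂
  have h₁₂ := inclusion_conjTranspose_mul_eq_zero hF eF₁ eF₂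
  have h₂₁ := inclusion_conjTranspose_mul_eq_zero hF.symm eF₂ eF₁
  simp only [gram, Matrix.of_apply, Matrix.add_apply, extendByZero_apply, star_add, add_mul,
    mul_add,
    Finset.sum_add_distrib, sum_mul_star_sum, sum_inclusion_mul, h₁, h₂, h₁₂, h₂₁,
    Matrix.zero_apply, mul_zero, Finset.sum_const_zero, add_zero, zero_add, Matrix.one_apply,
    mul_ite, mul_one, Finset.sum_ite_eq', Finset.mem_univ, if_true, star_star]

theorem sum_kernel_comm {c x : Type*} [Fintype c] [Fintype x] (A : x → x → ℂ)
    (g : c → x → x → ℂ) :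
    ∑ k, ∑ t, ∑ t', A t t' * g k t t' = ∑ t, ∑ t', A t t' * ∑ k, g k t t' := by
  rw [Finset.sum_comm]
  refine Finset.sum_congr rfl fun t _ => ?_
  rw [Finset.sum_comm]
  simp only [Finset.mul_sum]

theorem IsDirectSumOfPureCombs.gramConditions [Nonempty aI] [Nonempty aO] [Nonempty bI]
    [Nonempty bO] {U : Matrix (aI × bI × f) (p × aO × bO) ℂ} (h : IsDirectSumOfPureCombs U) :
    GramConditions U := by
  obtain ⟨P₁, P₂, F₁, F₂, -, -, hF, -, m₁, m₂, n₁, n₂, eP₁, eP₂, eF₁, eF₂, U₁, U₂, -, hU₁, -, hU₂,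
    rfl⟩ := h
  have h₁ := hU₁.combConditions
  rw [IsCombBA, swapSlots_choiProj] at hU₂
  have h₂ := hU₂.combConditions
  choose r₁ hr₁ using h₁.right
  choose l₁ hl₁ using h₁.left
  choose r₂ hr₂ using h₂.right
  choose l₂ hl₂ using h₂.left
  simp only [gram_swapOperator] at hr₂ hl₂
  -- The summand of order B ≺ A supplies the part trivial on aO, and the one of order A ≺ B the part
  -- trivial on bO. For the one-sided conditions, one summand uses its `right` condition summed over
  -- the traced input and the other its `left` condition.
  refine ⟨fun q q' j j' k k' => ⟨fun b b' => ∑ t, ∑ t', star (inclusion eP₂ q t) *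
      inclusion eP₂ q' t' * r₂ t t' k k' j j' b b', fun a a' => ∑ t, ∑ t',
      star (inclusion eP₁ q t) * inclusion eP₁ q' t' * r₁ t t' j j' k k' a a',
      fun a a' b b' => ?_⟩,
    fun q q' k k' a a' => ⟨(∑ t, ∑ t', star (inclusion eP₁ q t) *
      inclusion eP₁ q' t' * ∑ j, r₁ t t' j j k k' a a') + ∑ t, ∑ t',
      star (inclusion eP₂ q t) * inclusion eP₂ q' t' * l₂ t t' k k' a a', fun b b' => ?_⟩,
    fun q q' j j' b b' => ⟨(∑ t, ∑ t', star (inclusion eP₁ q t) *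
      inclusion eP₁ q' t' * l₁ t t' j j' b b') + ∑ t, ∑ t',
      star (inclusion eP₂ q t) * inclusion eP₂ q' t' * ∑ k, r₂ t t' k k j j' b b',
      fun a a' => ?_⟩⟩
  · rw [gram_extendByZero_add hF]
    simp only [hr₁, hr₂]
    split_ifs <;> simp [add_comm]
  · simp only [gram_extendByZero_add hF, Finset.sum_add_distrib, sum_kernel_comm, hr₁, hl₂]
    split_ifs <;> simp
  · simp only [gram_extendByZero_add hF, Finset.sum_add_distrib, sum_kernel_comm, hl₁, hr₂]
    split_ifs <;> simp

end DirectSums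

/-! ### Operators on P obtained by pulling back operators on A_I and B_I. -/

section Blocks

variable {p aI aO bI bO f : Type*}
  [Fintype p] [DecidableEq p] [Fintype f] [DecidableEq f]
  [Fintype aI] [DecidableEq aI] [Fintype aO] [DecidableEq aO]
  [Fintype bI] [DecidableEq bI] [Fintype bO] [DecidableEq bO]

/-- The blocks of `Uᴴ L U` with respect to `aO ⊗ bO`. -/
def block (U : Matrix (aI × bI × f) (p × aO × bO) ℂ)
    (L : Matrix (aI × bI × f) (aI × bI × f) ℂ) (r r' : aO × bO) : Matrix p p ℂ :=
  Matrix.of fun q q' => (Uᴴ * L * U) (q, r) (q', r')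

theorem block_conjTranspose (U : Matrix (aI × bI × f) (p × aO × bO) ℂ)
    (L : Matrix (aI × bI × f) (aI × bI × f) ℂ) (r r' : aO × bO) :
    (block U L r r')ᴴ = block U Lᴴ r' r := by
  ext q q'
  have : (Uᴴ * L * U)ᴴ = Uᴴ * Lᴴ * U := by
    simp only [Matrix.conjTranspose_mul, Matrix.conjTranspose_conjTranspose, Matrix.mul_assoc]
  simp only [block, ← this]
  rfl

theorem block_mul {U : Matrix (aI × bI × f) (p × aO × bO) ℂ} (hU : U * Uᴴ = 1)
    (L L' : Matrix (aI × bI × f) (aI × bI × f) ℂ) (r r' : aO × bO) :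
    block U (L * L') r r' = ∑ s, block U L r s * block U L' s r' := by
  ext q q'
  have : Uᴴ * (L * L') * U = Uᴴ * L * U * (Uᴴ * L' * U) := by
    calc Uᴴ * (L * L') * U = Uᴴ * L * ((1 : Matrix (aI × bI × f) (aI × bI × f) ℂ) * (L' * U)) := by
          rw [Matrix.one_mul]
          simp only [Matrix.mul_assoc]
      _ = Uᴴ * L * U * (Uᴴ * L' * U) := by
          rw [← hU]
          simp only [Matrix.mul_assoc]
  simp only [block, this]
  rw [Matrix.of_apply, Matrix.mul_apply, Fintype.sum_prod_type, Finset.sum_comm, Matrix.sum_apply]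
  rfl

/-- An operator on `aI`, acting on `aI ⊗ bI ⊗ f`. -/
def actA (bI f : Type*) [DecidableEq bI] [DecidableEq f] (A : Matrix aI aI ℂ) :
    Matrix (aI × bI × f) (aI × bI × f) ℂ :=
  A ⊗ₖ ((1 : Matrix bI bI ℂ) ⊗ₖ (1 : Matrix f f ℂ))

/-- An operator on `bI`, acting on `aI ⊗ bI ⊗ f`. -/
def actB (aI f : Type*) [DecidableEq aI] [DecidableEq f] (B : Matrix bI bI ℂ) :
    Matrix (aI × bI × f) (aI × bI × f) ℂ :=
  (1 : Matrix aI aI ℂ) ⊗ₖ (B ⊗ₖ (1 : Matrix f f ℂ))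

theorem actA_mul (A A' : Matrix aI aI ℂ) : actA bI f (A * A') = actA bI f A * actA bI f A' := by
  simp [actA, ← Matrix.mul_kronecker_mul]

theorem actA_conjTranspose (A : Matrix aI aI ℂ) : (actA bI f A)ᴴ = actA bI f Aᴴ := by
  simp [actA, Matrix.conjTranspose_kronecker]

theorem actB_conjTranspose (B : Matrix bI bI ℂ) : (actB aI f B)ᴴ = actB aI f Bᴴ := by
  simp [actB, Matrix.conjTranspose_kronecker]

theorem actA_mul_actB (A : Matrix aI aI ℂ) (B : Matrix bI bI ℂ) :
    actA bI f A * actB aI f B = A ⊗ₖ (B ⊗ₖ (1 : Matrix f f ℂ)) := by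
  simp [actA, actB, ← Matrix.mul_kronecker_mul]

theorem actB_mul_actA (A : Matrix aI aI ℂ) (B : Matrix bI bI ℂ) :
    actB aI f B * actA bI f A = A ⊗ₖ (B ⊗ₖ (1 : Matrix f f ℂ)) := by
  simp [actA, actB, ← Matrix.mul_kronecker_mul]

/-- Links the two languages: `gram` entries are, up to conjugation, the blocks of pulled-back
product operators that act as the identity on F. -/
theorem block_product (U : Matrix (aI × bI × f) (p × aO × bO) ℂ) (A : Matrix aI aI ℂ)
    (B : Matrix bI bI ℂ) (r r' : aO × bO) (q q' : p) :
    block U (A ⊗ₖ (B ⊗ₖ (1 : Matrix f f ℂ))) r r' q q' = ∑ j', ∑ k', ∑ j, ∑ k, A j j' * B k k' *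
      star (gram U q q' ((j, r.1), (k, r.2)) ((j', r'.1), (k', r'.2))) := by
  obtain ⟨a, b⟩ := r
  obtain ⟨a', b'⟩ := r'
  simp only [block, Matrix.of_apply, Matrix.mul_apply, Fintype.sum_prod_type,
    Matrix.conjTranspose_apply, Matrix.kroneckerMap_apply, gram, star_sum, Finset.mul_sum,
    Finset.sum_mul]
  refine Finset.sum_congr rfl fun j' _ => Finset.sum_congr rfl fun k' _ => ?_
  rw [Finset.sum_comm]
  refine Finset.sum_congr rfl fun j _ => ?_
  rw [Finset.sum_comm]
  refine Finset.sum_congr rfl fun k _ => Finset.sum_congr rfl fun c _ => ?_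
  rw [Finset.sum_eq_single c (fun d _ hd => by simp [hd]) (by simp)]
  simp only [Matrix.one_apply_eq, mul_one, star_mul, star_star]
  ring

variable {U : Matrix (aI × bI × f) (p × aO × bO) ℂ}

theorem GramConditions.block_actA (h : GramConditions U) (A : Matrix aI aI ℂ) (a₀ a a' : aO)
    (b b' : bO) : block U (actA bI f A) (a, b) (a', b') =
      if a = a' then block U (actA bI f A) (a₀, b) (a₀, b') else 0 := by
  ext q q'
  have : ∀ a a', block U (actA bI f A) (a, b) (a', b') q q' = ∑ j', ∑ j, A j j' *
      star (∑ k, gram U q q' ((j, a), (k, b)) ((j', a'), (k, b'))) := by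
    intro a a'
    rw [actA, block_product]
    simp only [Matrix.one_apply, mul_ite, mul_one, mul_zero, ite_mul, zero_mul, Finset.sum_ite_eq',
      Finset.mem_univ, if_true, star_sum, Finset.mul_sum]
    exact Finset.sum_congr rfl fun j' _ => Finset.sum_comm
  rw [apply_ite (fun M : Matrix p p ℂ => M q q'), this, this]
  have h2 : ∀ j j', ∑ k, gram U q q' ((j, a), (k, b)) ((j', a'), (k, b')) =
      if a = a' then ∑ k, gram U q q' ((j, a₀), (k, b)) ((j', a₀), (k, b')) else 0 := by
    intro j j'
    obtain ⟨t, ht⟩ := h.left q q' j j' b b'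
    simp [ht]
  simp only [h2]
  split_ifs <;> simp

theorem GramConditions.block_actB (h : GramConditions U) (B : Matrix bI bI ℂ) (b₀ : bO) (a a' : aO)
    (b b' : bO) : block U (actB aI f B) (a, b) (a', b') =
      if b = b' then block U (actB aI f B) (a, b₀) (a', b₀) else 0 := by
  ext q q'
  have : ∀ b b', block U (actB aI f B) (a, b) (a', b') q q' = ∑ k', ∑ k, B k k' *
      star (∑ j, gram U q q' ((j, a), (k, b)) ((j, a'), (k', b'))) := by
    intro b b'
    rw [actB, block_product]
    simp only [Matrix.one_apply, ite_mul, zero_mul, one_mul, Finset.sum_ite_irrel,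
      Finset.sum_const_zero, Finset.sum_ite_eq', Finset.mem_univ, if_true, star_sum, Finset.mul_sum]
    rw [Finset.sum_comm]
    exact Finset.sum_congr rfl fun k' _ => Finset.sum_comm
  rw [apply_ite (fun M : Matrix p p ℂ => M q q'), this, this]
  have h2 : ∀ k k', ∑ j, gram U q q' ((j, a), (k, b)) ((j, a'), (k', b')) =
      if b = b' then ∑ j, gram U q q' ((j, a), (k, b₀)) ((j, a'), (k', b₀)) else 0 := by
    intro k k'
    obtain ⟨t, ht⟩ := h.right q q' k k' a a'
    simp [ht]
  simp only [h2]
  split_ifs <;> simp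

/-- The blocks of `Uᴴ (A ⊗ 1 ⊗ 1) U` with respect to `bO`. -/
def blockA (U : Matrix (aI × bI × f) (p × aO × bO) ℂ) (a₀ : aO) (A : Matrix aI aI ℂ) (b b' : bO) :
    Matrix p p ℂ := block U (actA bI f A) (a₀, b) (a₀, b')

/-- The blocks of `Uᴴ (1 ⊗ B ⊗ 1) U` with respect to `aO`. -/
def blockB (U : Matrix (aI × bI × f) (p × aO × bO) ℂ) (b₀ : bO) (B : Matrix bI bI ℂ) (a a' : aO) :
    Matrix p p ℂ := block U (actB aI f B) (a, b₀) (a', b₀)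

theorem blockA_conjTranspose (a₀ : aO) (A : Matrix aI aI ℂ) (b b' : bO) :
    (blockA U a₀ A b b')ᴴ = blockA U a₀ Aᴴ b' b := by
  rw [blockA, block_conjTranspose, actA_conjTranspose, blockA]

theorem blockB_conjTranspose (b₀ : bO) (B : Matrix bI bI ℂ) (a a' : aO) :
    (blockB U b₀ B a a')ᴴ = blockB U b₀ Bᴴ a' a := by
  rw [blockB, block_conjTranspose, actB_conjTranspose, blockB]

theorem GramConditions.blockA_mul (h : GramConditions U) (hU : U * Uᴴ = 1) (a₀ : aO)
    (A A' : Matrix aI aI ℂ) (b b' : bO) :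
    blockA U a₀ (A * A') b b' = ∑ c, blockA U a₀ A b c * blockA U a₀ A' c b' := by
  rw [blockA, actA_mul, block_mul hU, Fintype.sum_prod_type, Finset.sum_eq_single a₀]
  · rfl
  · intro a _ ha
    refine Finset.sum_eq_zero fun c _ => ?_
    rw [h.block_actA A a₀ a₀ a, if_neg ha.symm, Matrix.zero_mul]
  · simp

/-- Each factor is trivial on one output, so the block product has a single surviving term. With
`blockB_mul_blockA`, whose right-hand side is the same, it shows that the two families commute. -/
theorem GramConditions.blockA_mul_blockB (h : GramConditions U) (hU : U * Uᴴ = 1) (a₀ : aO)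
    (b₀ : bO) (A : Matrix aI aI ℂ) (B : Matrix bI bI ℂ) (a a' : aO) (b b' : bO) :
    blockA U a₀ A b b' * blockB U b₀ B a a' =
      block U (A ⊗ₖ (B ⊗ₖ (1 : Matrix f f ℂ))) (a, b) (a', b') := by
  rw [← actA_mul_actB, block_mul hU, Fintype.sum_prod_type, Finset.sum_eq_single a,
    Finset.sum_eq_single b']
  · rw [h.block_actA A a₀ a a, if_pos rfl, h.block_actB B b₀ a a' b' b', if_pos rfl]
    rfl
  · intro c _ hc
    rw [h.block_actB B b₀ a a' c, if_neg hc, Matrix.mul_zero]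
  · simp
  · intro c _ hc
    refine Finset.sum_eq_zero fun d _ => ?_
    rw [h.block_actA A a₀ a c, if_neg hc.symm, Matrix.zero_mul]
  · simp

theorem GramConditions.blockB_mul_blockA (h : GramConditions U) (hU : U * Uᴴ = 1) (a₀ : aO)
    (b₀ : bO) (A : Matrix aI aI ℂ) (B : Matrix bI bI ℂ) (a a' : aO) (b b' : bO) :
    blockB U b₀ B a a' * blockA U a₀ A b b' =
      block U (A ⊗ₖ (B ⊗ₖ (1 : Matrix f f ℂ))) (a, b) (a', b') := by
  rw [← actB_mul_actA, block_mul hU, Fintype.sum_prod_type, Finset.sum_eq_single a',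
    Finset.sum_eq_single b]
  · rw [h.block_actA A a₀ a' a', if_pos rfl, h.block_actB B b₀ a a' b b, if_pos rfl]
    rfl
  · intro c _ hc
    rw [h.block_actB B b₀ a a' b c, if_neg hc.symm, Matrix.zero_mul]
  · simp
  · intro c _ hc
    refine Finset.sum_eq_zero fun d _ => ?_
    rw [h.block_actA A a₀ c a', if_neg hc, Matrix.mul_zero]
  · simp

/-- The part of `blockA` that is not trivial on `bO`. -/
def offA (U : Matrix (aI × bI × f) (p × aO × bO) ℂ) (a₀ : aO) (b₀ : bO) (A : Matrix aI aI ℂ)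
    (b b' : bO) : Matrix p p ℂ :=
  blockA U a₀ A b b' - if b = b' then blockA U a₀ A b₀ b₀ else 0

/-- The part of `blockB` that is not trivial on `aO`. -/
def offB (U : Matrix (aI × bI × f) (p × aO × bO) ℂ) (a₀ : aO) (b₀ : bO) (B : Matrix bI bI ℂ)
    (a a' : aO) : Matrix p p ℂ :=
  blockB U b₀ B a a' - if a = a' then blockB U b₀ B a₀ a₀ else 0

theorem offA_conjTranspose (a₀ : aO) (b₀ : bO) (A : Matrix aI aI ℂ) (b b' : bO) :
    (offA U a₀ b₀ A b b')ᴴ = offA U a₀ b₀ Aᴴ b' b := by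
  rw [offA, offA, Matrix.conjTranspose_sub, blockA_conjTranspose]
  by_cases hb : b = b'
  · simp [hb, blockA_conjTranspose]
  · simp [hb, Ne.symm hb]

/-- Expanding gives four blocks of A ⊗ B ⊗ 1 with alternating signs, exactly the combination that
`both_eq` makes vanish. This is where the absence of a part nontrivial on both outputs enters. -/
theorem GramConditions.offB_mul_offA (h : GramConditions U) (hU : U * Uᴴ = 1) (a₀ : aO)
    (b₀ : bO) (A : Matrix aI aI ℂ) (B : Matrix bI bI ℂ) (a a' : aO) (b b' : bO) :
    offB U a₀ b₀ B a a' * offA U a₀ b₀ A b b' = 0 := by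
  have key : block U (A ⊗ₖ (B ⊗ₖ (1 : Matrix f f ℂ))) (a, b) (a', b') =
      (if a = a' then block U (A ⊗ₖ (B ⊗ₖ (1 : Matrix f f ℂ))) (a₀, b) (a₀, b') else 0) +
      (if b = b' then block U (A ⊗ₖ (B ⊗ₖ (1 : Matrix f f ℂ))) (a, b₀) (a', b₀) else 0) -
      (if a = a' then (if b = b' then
        block U (A ⊗ₖ (B ⊗ₖ (1 : Matrix f f ℂ))) (a₀, b₀) (a₀, b₀) else 0) else 0) := by
    ext q q'
    have hb := h.both_eq a₀ b₀ q q'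
    simp only [apply_ite (fun M : Matrix p p ℂ => M q q'), Matrix.add_apply, Matrix.sub_apply,
      block_product]
    simp only [hb (_, a) (_, a') (_, b) (_, b'), star_add, star_sub, mul_add, mul_sub,
      Finset.sum_add_distrib, Finset.sum_sub_distrib]
    split_ifs <;> simp
  rw [offA, offB]
  simp only [sub_mul, mul_sub, ite_mul, mul_ite, zero_mul, mul_zero, h.blockB_mul_blockA hU]
  rw [key]
  split_ifs <;> abel

end Blocks

/-! ### The reducing subspace of P and its transfer to F. -/

section Decomposition

variable {p aI aO bI bO f : Type*}
  [Fintype p] [DecidableEq p] [Fintype f] [DecidableEq f]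
  [Fintype aI] [DecidableEq aI] [Fintype aO] [DecidableEq aO]
  [Fintype bI] [DecidableEq bI] [Fintype bO] [DecidableEq bO]

/-- The matrices whose range lies in `S`. -/
def rangeIn {x : Type*} [Fintype x] (S : Submodule ℂ (EuclideanSpace ℂ x)) :
    Submodule ℂ (Matrix x x ℂ) where
  carrier := {M | ∀ w, WithLp.toLp 2 (M *ᵥ w) ∈ S}
  add_mem' hM hN w := by
    rw [Matrix.add_mulVec, WithLp.toLp_add]
    exact S.add_mem (hM w) (hN w)
  zero_mem' w := by
    rw [Matrix.zero_mulVec, WithLp.toLp_zero]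
    exact S.zero_mem
  smul_mem' c M hM w := by
    rw [Matrix.smul_mulVec, WithLp.toLp_smul]
    exact S.smul_mem c (hM w)

theorem mul_mem_rangeIn {x : Type*} [Fintype x] {S : Submodule ℂ (EuclideanSpace ℂ x)}
    {M : Matrix x x ℂ} (hM : M ∈ rangeIn S) (N : Matrix x x ℂ) : M * N ∈ rangeIn S := by
  intro w
  rw [← Matrix.mulVec_mulVec]
  exact hM _

theorem column_mem_of_mem_rangeIn {x : Type*} [Fintype x] [DecidableEq x]
    {S : Submodule ℂ (EuclideanSpace ℂ x)} {M : Matrix x x ℂ} (hM : M ∈ rangeIn S) (t : x) :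
    WithLp.toLp 2 (fun k => M k t) ∈ S := by
  have h := hM (Pi.single t 1)
  rwa [Matrix.mulVec_single_one] at h

variable {U : Matrix (aI × bI × f) (p × aO × bO) ℂ}

/-- The span of the ranges of all `offA`. -/
def offRange (U : Matrix (aI × bI × f) (p × aO × bO) ℂ) (a₀ : aO) (b₀ : bO) :
    Submodule ℂ (EuclideanSpace ℂ p) :=
  Submodule.span ℂ {v | ∃ A b b' w, v = WithLp.toLp 2 (offA U a₀ b₀ A b b' *ᵥ w)}

theorem offA_mem (a₀ : aO) (b₀ : bO) (A : Matrix aI aI ℂ) (b b' : bO) :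
    offA U a₀ b₀ A b b' ∈ rangeIn (offRange U a₀ b₀) :=
  fun w => Submodule.subset_span ⟨A, b, b', w, rfl⟩

theorem mulVec_mem_offRange {a₀ : aO} {b₀ : bO} {M : Matrix p p ℂ}
    (hM : ∀ A b b', M * offA U a₀ b₀ A b b' ∈ rangeIn (offRange U a₀ b₀))
    (v : EuclideanSpace ℂ p) (hv : v ∈ offRange U a₀ b₀) :
    WithLp.toLp 2 (M *ᵥ v) ∈ offRange U a₀ b₀ := by
  induction hv using Submodule.span_induction with
  | mem v hv =>
    obtain ⟨A, b, b', w, rfl⟩ := hv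
    have := hM A b b' w
    rwa [← Matrix.mulVec_mulVec] at this
  | zero => simp
  | add v w _ _ hv hw =>
    rw [WithLp.ofLp_add, Matrix.mulVec_add, WithLp.toLp_add]
    exact Submodule.add_mem _ hv hw
  | smul c v _ hv =>
    rw [WithLp.ofLp_smul, Matrix.mulVec_smul, WithLp.toLp_smul]
    exact Submodule.smul_mem _ c hv

theorem GramConditions.blockB_mul_offA_mem (h : GramConditions U) (hU : U * Uᴴ = 1) (a₀ : aO)
    (b₀ : bO) (B : Matrix bI bI ℂ) (a a' : aO) (A : Matrix aI aI ℂ) (b b' : bO) :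
    blockB U b₀ B a a' * offA U a₀ b₀ A b b' ∈ rangeIn (offRange U a₀ b₀) := by
  have : blockB U b₀ B a a' * offA U a₀ b₀ A b b' =
      offA U a₀ b₀ A b b' * blockB U b₀ B a a' := by
    simp only [offA, mul_sub, sub_mul, mul_ite, ite_mul, mul_zero, zero_mul,
      h.blockB_mul_blockA hU, h.blockA_mul_blockB hU]
  rw [this]
  exact mul_mem_rangeIn (offA_mem _ _ _ _ _) _

/-- By multiplicativity, left multiplication by a block turns an `offA` into an `offA` of the
product plus terms that begin with an `offA`. -/
theorem GramConditions.blockA_mul_offA_mem (h : GramConditions U) (hU : U * Uᴴ = 1) (a₀ : aO)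
    (b₀ : bO) (A A' : Matrix aI aI ℂ) (b b' c c' : bO) :
    blockA U a₀ A b b' * offA U a₀ b₀ A' c c' ∈ rangeIn (offRange U a₀ b₀) := by
  have hA : ∀ b b', blockA U a₀ A b b' =
      offA U a₀ b₀ A b b' + if b = b' then blockA U a₀ A b₀ b₀ else 0 := by
    intro b b'
    rw [offA, sub_add_cancel]
  -- In the block product for A * A', replacing the left factor at (c, d) by its difference from
  -- `offA` leaves only the scalar block at d = c.
  have hz : ∀ c c', blockA U a₀ A b₀ b₀ * blockA U a₀ A' c c' = blockA U a₀ (A * A') c c' -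
      ∑ d, offA U a₀ b₀ A c d * blockA U a₀ A' d c' := by
    intro c c'
    rw [h.blockA_mul hU, ← Finset.sum_sub_distrib]
    simp only [← sub_mul]
    rw [Finset.sum_eq_single c]
    · simp [offA]
    · intro d _ hd
      simp [offA, hd.symm]
    · simp
  have hsum : ∀ c c', ∑ d, offA U a₀ b₀ A c d * blockA U a₀ A' d c' ∈
      rangeIn (offRange U a₀ b₀) := fun c c' =>
    Submodule.sum_mem _ fun d _ => mul_mem_rangeIn (offA_mem _ _ _ _ _) _
  have h0 : blockA U a₀ A b₀ b₀ * offA U a₀ b₀ A' c c' ∈ rangeIn (offRange U a₀ b₀) := by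
    -- The difference of `hz` at (c, c') and, when c = c', at (b₀, b₀).
    have : blockA U a₀ A b₀ b₀ * offA U a₀ b₀ A' c c' = offA U a₀ b₀ (A * A') c c' -
        (∑ d, offA U a₀ b₀ A c d * blockA U a₀ A' d c') +
        if c = c' then ∑ d, offA U a₀ b₀ A b₀ d * blockA U a₀ A' d b₀ else 0 := by
      rw [offA, mul_sub, mul_ite, mul_zero, hz, hz, offA]
      split_ifs <;> abel
    rw [this]
    refine Submodule.add_mem _ (Submodule.sub_mem _ (offA_mem _ _ _ _ _) (hsum c c')) ?_
    split_ifs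
    · exact hsum _ _
    · exact Submodule.zero_mem _
  rw [hA, add_mul, ite_mul, zero_mul]
  refine Submodule.add_mem _ (mul_mem_rangeIn (offA_mem _ _ _ _ _) _) ?_
  split_ifs
  · exact h0
  · exact Submodule.zero_mem _

/-- The family `offA` is closed under adjoints, so the orthogonal complement of its ranges lies in
all its kernels. -/
theorem offA_mul_inclusion {a₀ : aO} {b₀ : bO} {n : ℕ}
    (e : OrthonormalBasis (Fin n) ℂ (offRange U a₀ b₀)ᗮ) (A : Matrix aI aI ℂ) (b b' : bO) :
    offA U a₀ b₀ A b b' * inclusion e = 0 := by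
  have h := inclusion_conjTranspose_mul_orthogonal e (M := offA U a₀ b₀ Aᴴ b' b)
    (column_mem_of_mem_rangeIn (offA_mem _ _ _ _ _))
  have h' := congrArg Matrix.conjTranspose h
  rwa [Matrix.conjTranspose_mul, offA_conjTranspose, Matrix.conjTranspose_conjTranspose,
    Matrix.conjTranspose_conjTranspose, Matrix.conjTranspose_zero] at h'

theorem GramConditions.offB_mul_inclusion (h : GramConditions U) (hU : U * Uᴴ = 1) {a₀ : aO}
    {b₀ : bO} {n : ℕ} (e : OrthonormalBasis (Fin n) ℂ (offRange U a₀ b₀)) (B : Matrix bI bI ℂ)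
    (a a' : aO) : offB U a₀ b₀ B a a' * inclusion e = 0 := by
  have hv : ∀ v ∈ offRange U a₀ b₀, offB U a₀ b₀ B a a' *ᵥ v.ofLp = 0 := by
    intro v hv
    induction hv using Submodule.span_induction with
    | mem v hv =>
      obtain ⟨A, b, b', w, rfl⟩ := hv
      rw [Matrix.mulVec_mulVec, h.offB_mul_offA hU, Matrix.zero_mulVec]
    | zero => simp
    | add v w _ _ hv hw => rw [WithLp.ofLp_add, Matrix.mulVec_add, hv, hw, add_zero]
    | smul c v _ hv => rw [WithLp.ofLp_smul, Matrix.mulVec_smul, hv, smul_zero]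
  ext k t
  exact congrFun (hv _ (e t).2) k

theorem GramConditions.block_actA_comm (h : GramConditions U) (hU : U * Uᴴ = 1) {a₀ : aO}
    {b₀ : bO} {n : ℕ} (e : OrthonormalBasis (Fin n) ℂ (offRange U a₀ b₀)) (A : Matrix aI aI ℂ)
    (r r' : aO × bO) :
    block U (actA bI f A) r r' * (inclusion e * (inclusion e)ᴴ) =
      inclusion e * (inclusion e)ᴴ * block U (actA bI f A) r r' := by
  obtain ⟨a, b⟩ := r
  obtain ⟨a', b'⟩ := r'
  rw [h.block_actA A a₀ a a']
  split_ifs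
  · refine commute_inclusion e (mulVec_mem_offRange fun A' c c' =>
      h.blockA_mul_offA_mem hU a₀ b₀ A A' b b' c c') ?_
    have := blockA_conjTranspose (U := U) a₀ A b b'
    rw [blockA] at this
    rw [this]
    exact mulVec_mem_offRange fun A' c c' => h.blockA_mul_offA_mem hU a₀ b₀ Aᴴ A' b' b c c'
  · simp

theorem GramConditions.block_actB_comm (h : GramConditions U) (hU : U * Uᴴ = 1) {a₀ : aO}
    {b₀ : bO} {n : ℕ} (e : OrthonormalBasis (Fin n) ℂ (offRange U a₀ b₀)) (B : Matrix bI bI ℂ)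
    (r r' : aO × bO) :
    block U (actB aI f B) r r' * (inclusion e * (inclusion e)ᴴ) =
      inclusion e * (inclusion e)ᴴ * block U (actB aI f B) r r' := by
  obtain ⟨a, b⟩ := r
  obtain ⟨a', b'⟩ := r'
  rw [h.block_actB B b₀ a a']
  split_ifs
  · refine commute_inclusion e (mulVec_mem_offRange fun A' c c' =>
      h.blockB_mul_offA_mem hU a₀ b₀ B a a' A' c c') ?_
    have := blockB_conjTranspose (U := U) b₀ B a a'
    rw [blockB] at this
    rw [this]
    exact mulVec_mem_offRange fun A' c c' => h.blockB_mul_offA_mem hU a₀ b₀ Bᴴ a' a A' c c'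
  · simp

theorem conj_comm_of_block_comm (hU : IsUnitary U) {Q : Matrix p p ℂ}
    {L : Matrix (aI × bI × f) (aI × bI × f) ℂ}
    (h : ∀ r r', block U L r r' * Q = Q * block U L r r') :
    U * (Q ⊗ₖ ((1 : Matrix aO aO ℂ) ⊗ₖ (1 : Matrix bO bO ℂ))) * Uᴴ * L =
      L * (U * (Q ⊗ₖ ((1 : Matrix aO aO ℂ) ⊗ₖ (1 : Matrix bO bO ℂ))) * Uᴴ) := by
  set R := Q ⊗ₖ ((1 : Matrix aO aO ℂ) ⊗ₖ (1 : Matrix bO bO ℂ)) with hR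
  have hcomm : Uᴴ * L * U * R = R * (Uᴴ * L * U) := by
    ext ⟨q, r⟩ ⟨q', r'⟩
    have := congrFun (congrFun (h r r') q) q'
    rw [Matrix.mul_apply, Matrix.mul_apply] at this
    rw [Matrix.mul_apply, Matrix.mul_apply, Fintype.sum_prod_type, Fintype.sum_prod_type]
    simpa [hR, Matrix.one_apply, block] using this
  calc U * R * Uᴴ * L = U * R * Uᴴ * L * (U * Uᴴ) := by rw [hU.2, Matrix.mul_one]
    _ = U * (R * (Uᴴ * L * U)) * Uᴴ := by simp only [Matrix.mul_assoc]
    _ = U * (Uᴴ * L * U * R) * Uᴴ := by rw [hcomm]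
    _ = U * Uᴴ * (L * (U * R * Uᴴ)) := by simp only [Matrix.mul_assoc]
    _ = L * (U * R * Uᴴ) := by rw [hU.2, Matrix.one_mul]

/-- The commutant of the full matrix algebras on A_I and B_I consists of operators on F; the matrix
units `single j' j₀` and `single k' k₀` read this off entry by entry. -/
theorem exists_eq_kronecker [Nonempty aI] [Nonempty bI] {Q : Matrix (aI × bI × f) (aI × bI × f) ℂ}
    (hA : ∀ A, Q * actA bI f A = actA bI f A * Q) (hB : ∀ B, Q * actB aI f B = actB aI f B * Q) :
    ∃ q : Matrix f f ℂ, Q = (1 : Matrix aI aI ℂ) ⊗ₖ ((1 : Matrix bI bI ℂ) ⊗ₖ q) := by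
  obtain ⟨j₀⟩ := ‹Nonempty aI›
  obtain ⟨k₀⟩ := ‹Nonempty bI›
  have h1 : ∀ j j' k k' c c', Q (j, k, c) (j', k', c') =
      if j = j' then Q (j₀, k, c) (j₀, k', c') else 0 := by
    intro j j' k k' c c'
    have := congrFun (congrFun (hA (Matrix.single j' j₀ 1)) (j, k, c)) (j₀, k', c')
    simpa [actA, Matrix.mul_apply, Fintype.sum_prod_type, Matrix.single_apply, Matrix.one_apply,
      ite_and, eq_comm (a := j')] using this
  have h2 : ∀ j k k' c c', Q (j, k, c) (j, k', c') =
      if k = k' then Q (j, k₀, c) (j, k₀, c') else 0 := by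
    intro j k k' c c'
    have := congrFun (congrFun (hB (Matrix.single k' k₀ 1)) (j, k, c)) (j, k₀, c')
    simpa [actB, Matrix.mul_apply, Fintype.sum_prod_type, Matrix.single_apply, Matrix.one_apply,
      ite_and, eq_comm (a := k')] using this
  refine ⟨Matrix.of fun c c' => Q (j₀, k₀, c) (j₀, k₀, c'), ?_⟩
  ext ⟨j, k, c⟩ ⟨j', k', c'⟩
  rw [h1, h2]
  simp only [Matrix.kroneckerMap_apply, Matrix.one_apply, Matrix.of_apply]
  split_ifs <;> simp

end Decomposition

/-! ### Cutting `U` into its two combs. -/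

section Restriction

variable {p aI aO bI bO f : Type*}
  [Fintype p] [DecidableEq p] [Fintype f] [DecidableEq f]
  [Fintype aI] [DecidableEq aI] [Fintype aO] [DecidableEq aO]
  [Fintype bI] [DecidableEq bI] [Fintype bO] [DecidableEq bO]

/-- An operator from `p`, acting on `p ⊗ aO ⊗ bO`. -/
def actP {m : Type*} (aO bO : Type*) [DecidableEq aO] [DecidableEq bO] (M : Matrix p m ℂ) :
    Matrix (p × aO × bO) (m × aO × bO) ℂ :=
  M ⊗ₖ ((1 : Matrix aO aO ℂ) ⊗ₖ (1 : Matrix bO bO ℂ))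

/-- An operator from `f`, acting on `aI ⊗ bI ⊗ f`. -/
def actF {n : Type*} (aI bI : Type*) [DecidableEq aI] [DecidableEq bI] (M : Matrix f n ℂ) :
    Matrix (aI × bI × f) (aI × bI × n) ℂ :=
  (1 : Matrix aI aI ℂ) ⊗ₖ ((1 : Matrix bI bI ℂ) ⊗ₖ M)

theorem actP_mul {m x : Type*} [Fintype m] (M : Matrix p m ℂ) (N : Matrix m x ℂ) :
    actP aO bO (M * N) = actP aO bO M * actP aO bO N := by
  simp [actP, ← Matrix.mul_kronecker_mul]

theorem actF_mul {n x : Type*} [Fintype n] (M : Matrix f n ℂ) (N : Matrix n x ℂ) :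
    actF aI bI (M * N) = actF aI bI M * actF aI bI N := by
  simp [actF, ← Matrix.mul_kronecker_mul]

theorem actP_conjTranspose {m : Type*} (M : Matrix p m ℂ) :
    (actP aO bO M)ᴴ = actP aO bO Mᴴ := by
  simp [actP, Matrix.conjTranspose_kronecker]

theorem actF_conjTranspose {n : Type*} (M : Matrix f n ℂ) :
    (actF aI bI M)ᴴ = actF aI bI Mᴴ := by
  simp [actF, Matrix.conjTranspose_kronecker]

theorem actP_one : actP aO bO (1 : Matrix p p ℂ) = 1 := by
  simp [actP]

theorem actF_one : actF aI bI (1 : Matrix f f ℂ) = 1 := by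
  simp [actF]

variable {m n : ℕ} {P' : Submodule ℂ (EuclideanSpace ℂ p)} {F' : Submodule ℂ (EuclideanSpace ℂ f)}

/-- The operator `P' ⊗ aO ⊗ bO → aI ⊗ bI ⊗ F'` cut out of `U`. -/
def restriction (eP : OrthonormalBasis (Fin m) ℂ P') (eF : OrthonormalBasis (Fin n) ℂ F')
    (U : Matrix (aI × bI × f) (p × aO × bO) ℂ) : Matrix (aI × bI × Fin n) (Fin m × aO × bO) ℂ :=
  actF aI bI (inclusion eF)ᴴ * U * actP aO bO (inclusion eP)

variable {U : Matrix (aI × bI × f) (p × aO × bO) ℂ} {eP : OrthonormalBasis (Fin m) ℂ P'}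
  {eF : OrthonormalBasis (Fin n) ℂ F'}

/-- The hypothesis says that `U` intertwines the projections onto P' and F', so `U` maps P' ⊗ A_O ⊗
B_O into A_I ⊗ B_I ⊗ F' and restricting loses nothing. -/
theorem actF_mul_restriction
    (h : actF aI bI (inclusion eF * (inclusion eF)ᴴ) * U =
      U * actP aO bO (inclusion eP * (inclusion eP)ᴴ)) :
    actF aI bI (inclusion eF) * restriction eP eF U = U * actP aO bO (inclusion eP) := by
  rw [restriction, ← Matrix.mul_assoc, ← Matrix.mul_assoc, ← actF_mul, h, Matrix.mul_assoc,
    ← actP_mul, Matrix.mul_assoc, inclusion_isometry, Matrix.mul_one]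

theorem extendByZero_restriction
    (h : actF aI bI (inclusion eF * (inclusion eF)ᴴ) * U =
      U * actP aO bO (inclusion eP * (inclusion eP)ᴴ)) :
    extendByZero eP eF (restriction eP eF U) =
      U * actP aO bO (inclusion eP * (inclusion eP)ᴴ) := by
  rw [actP_mul, ← Matrix.mul_assoc, ← actF_mul_restriction h]
  rfl

theorem isUnitary_restriction (hU : IsUnitary U)
    (h : actF aI bI (inclusion eF * (inclusion eF)ᴴ) * U =
      U * actP aO bO (inclusion eP * (inclusion eP)ᴴ)) :
    IsUnitary (restriction eP eF U) := by
  have hct : (restriction eP eF U)ᴴ =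
      actP aO bO (inclusion eP)ᴴ * Uᴴ * actF aI bI (inclusion eF) := by
    rw [restriction, Matrix.conjTranspose_mul, Matrix.conjTranspose_mul, actF_conjTranspose,
      actP_conjTranspose, Matrix.conjTranspose_conjTranspose, Matrix.mul_assoc]
  constructor
  · rw [hct, Matrix.mul_assoc, actF_mul_restriction h, Matrix.mul_assoc, ← Matrix.mul_assoc Uᴴ,
      hU.1, Matrix.one_mul, ← actP_mul, inclusion_isometry, actP_one]
  · calc restriction eP eF U * (restriction eP eF U)ᴴ
        = actF aI bI (inclusion eF)ᴴ * (U * actP aO bO (inclusion eP * (inclusion eP)ᴴ)) * Uᴴ *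
          actF aI bI (inclusion eF) := by
          rw [hct, restriction, actP_mul]
          simp only [Matrix.mul_assoc]
      _ = actF aI bI ((inclusion eF)ᴴ * inclusion eF * (inclusion eF)ᴴ) * (U * Uᴴ) *
          actF aI bI (inclusion eF) := by
          rw [← h]
          simp only [actF_mul, Matrix.mul_assoc]
      _ = 1 := by
          rw [hU.2, Matrix.mul_one, ← actF_mul, inclusion_isometry, Matrix.one_mul,
            inclusion_isometry, actF_one]

theorem gram_restriction
    (h : actF aI bI (inclusion eF * (inclusion eF)ᴴ) * U =
      U * actP aO bO (inclusion eP * (inclusion eP)ᴴ)) (t t' : Fin m)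
    (k l : (aI × aO) × (bI × bO)) :
    gram (restriction eP eF U) t t' k l = ∑ q, ∑ q', inclusion eP q t * star (inclusion eP q' t') *
      gram U q q' k l := by
  have h1 : ∀ j k c t a b, ∑ s, inclusion eF c s * restriction eP eF U (j, k, s) (t, a, b) =
      ∑ q, inclusion eP q t * U (j, k, c) (q, a, b) := by
    intro j k c t a b
    have := congrFun (congrFun (actF_mul_restriction h) (j, k, c)) (t, a, b)
    simpa [actF, actP, Matrix.mul_apply, Fintype.sum_prod_type, Matrix.one_apply,
      mul_comm] using this
  have h2 := sum_inclusion_mul eF eF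
    (fun s => restriction eP eF U (k.1.1, k.2.1, s) (t, k.1.2, k.2.2))
    (fun s => restriction eP eF U (l.1.1, l.2.1, s) (t', l.1.2, l.2.2))
  simp only [h1, sum_mul_star_sum, inclusion_isometry, Matrix.one_apply, mul_ite, mul_one, mul_zero,
    Finset.sum_ite_eq', Finset.mem_univ, if_true] at h2
  exact h2.symm

theorem star_gram_restriction
    (h : actF aI bI (inclusion eF * (inclusion eF)ᴴ) * U =
      U * actP aO bO (inclusion eP * (inclusion eP)ᴴ)) (t t' : Fin m) (j j' : aI) (a a' : aO)
    (k k' : bI) (b b' : bO) :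
    star (gram (restriction eP eF U) t t' ((j, a), (k, b)) ((j', a'), (k', b'))) =
      ((inclusion eP)ᴴ * (block U (Matrix.single j j' 1 ⊗ₖ (Matrix.single k k' 1 ⊗ₖ
        (1 : Matrix f f ℂ))) (a, b) (a', b') * inclusion eP)) t t' := by
  have h1 : ∀ q q', block U (Matrix.single j j' 1 ⊗ₖ (Matrix.single k k' 1 ⊗ₖ
      (1 : Matrix f f ℂ))) (a, b) (a', b') q q' =
      star (gram U q q' ((j, a), (k, b)) ((j', a'), (k', b'))) := by
    intro q q'
    rw [block_product, Finset.sum_eq_single j', Finset.sum_eq_single k', Finset.sum_eq_single j,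
      Finset.sum_eq_single k]
    · simp
    · intro x _ hx
      simp [hx.symm]
    · simp
    · intro x _ hx
      simp [hx.symm]
    · simp
    · intro x _ hx
      simp [hx.symm]
    · simp
    · intro x _ hx
      simp [hx.symm]
    · simp
  simp only [gram_restriction h, Matrix.mul_apply, Matrix.conjTranspose_apply, h1, star_sum,
    star_mul, star_star, Finset.mul_sum]
  exact Finset.sum_congr rfl fun q _ => Finset.sum_congr rfl fun q' _ => by ring

/-- Where all `offA` vanish, `blockA` is trivial on bO, hence so is the whole of `gram`. The
condition `left` is inherited from `U` by linearity. -/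
theorem GramConditions.combConditions_restriction (hG : GramConditions U) (hU : U * Uᴴ = 1)
    {a₀ : aO} {b₀ : bO}
    (h : actF aI bI (inclusion eF * (inclusion eF)ᴴ) * U =
      U * actP aO bO (inclusion eP * (inclusion eP)ᴴ))
    (hA : ∀ A b b', offA U a₀ b₀ A b b' * inclusion eP = 0) :
    CombConditions (restriction eP eF U) := by
  choose l hl using hG.left
  refine ⟨fun t t' j j' k k' a a' => ⟨star (((inclusion eP)ᴴ *
    (blockB U b₀ (Matrix.single k k' 1) a a' * (blockA U a₀ (Matrix.single j j' 1) b₀ b₀ *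
      inclusion eP))) t t'), fun b b' => ?_⟩,
    fun t t' j j' b b' => ⟨∑ q, ∑ q', inclusion eP q t * star (inclusion eP q' t') *
      l q q' j j' b b', fun a a' => ?_⟩⟩
  · have h1 := hA (Matrix.single j j' 1) b b'
    rw [offA, Matrix.sub_mul, sub_eq_zero] at h1
    -- The block is factored with `blockA` on the right, next to the inclusion that `offA`
    -- annihilates; the swapped version below uses the opposite order for `offB`.
    rw [← star_inj, star_gram_restriction h, ← hG.blockB_mul_blockA hU a₀ b₀, Matrix.mul_assoc, h1]
    split_ifs <;> simp
  · simp only [gram_restriction h, sum_kernel_comm, hl]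
    split_ifs <;> simp

theorem GramConditions.combConditions_swapOperator_restriction (hG : GramConditions U)
    (hU : U * Uᴴ = 1) {a₀ : aO} {b₀ : bO}
    (h : actF aI bI (inclusion eF * (inclusion eF)ᴴ) * U =
      U * actP aO bO (inclusion eP * (inclusion eP)ᴴ))
    (hB : ∀ B a a', offB U a₀ b₀ B a a' * inclusion eP = 0) :
    CombConditions (swapOperator (restriction eP eF U)) := by
  choose r hr using hG.right
  refine ⟨fun t t' k k' j j' b b' => ⟨star (((inclusion eP)ᴴ *
    (blockA U a₀ (Matrix.single j j' 1) b b' * (blockB U b₀ (Matrix.single k k' 1) a₀ a₀ *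
      inclusion eP))) t t'), fun a a' => ?_⟩,
    fun t t' k k' a a' => ⟨∑ q, ∑ q', inclusion eP q t * star (inclusion eP q' t') *
      r q q' k k' a a', fun b b' => ?_⟩⟩
  · have h1 := hB (Matrix.single k k' 1) a a'
    rw [offB, Matrix.sub_mul, sub_eq_zero] at h1
    rw [gram_swapOperator, ← star_inj, star_gram_restriction h, ← hG.blockA_mul_blockB hU a₀ b₀,
      Matrix.mul_assoc, h1]
    split_ifs <;> simp
  · simp only [gram_swapOperator, gram_restriction h, sum_kernel_comm, hr]
    split_ifs <;> simp

theorem swapOperator_isometry (hU : Uᴴ * U = 1) : (swapOperator U)ᴴ * swapOperator U = 1 := by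
  ext ⟨q, b, a⟩ ⟨q', b', a'⟩
  have h := congrFun (congrFun hU (q, a, b)) (q', a', b')
  simp only [Matrix.mul_apply, Fintype.sum_prod_type, Matrix.conjTranspose_apply, Matrix.one_apply,
    Prod.mk.injEq, swapOperator, Matrix.submatrix_apply] at h ⊢
  rw [Finset.sum_comm, h]
  simp only [and_comm]

theorem GramConditions.isDirectSumOfPureCombs [Nonempty aI] [Nonempty aO] [Nonempty bI]
    [Nonempty bO] (h : GramConditions U) (hU : IsUnitary U) : IsDirectSumOfPureCombs U := by
  obtain ⟨a₀⟩ := ‹Nonempty aO›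
  obtain ⟨b₀⟩ := ‹Nonempty bO›
  obtain ⟨j₀⟩ := ‹Nonempty aI›
  obtain ⟨k₀⟩ := ‹Nonempty bI›
  -- Every `offB` vanishes on P₂, so it carries the order B ≺ A; its complement carries A ≺ B.
  let P₂ := offRange U a₀ b₀
  let e₂ := stdOrthonormalBasis ℂ P₂
  let e₁ := stdOrthonormalBasis ℂ P₂ᗮ
  set R := inclusion e₂ * (inclusion e₂)ᴴ with hR
  have hR' : Rᴴ = R := by
    rw [hR, Matrix.conjTranspose_mul, Matrix.conjTranspose_conjTranspose]
  have hR'' : R * R = R := by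
    rw [hR, Matrix.mul_assoc, ← Matrix.mul_assoc (inclusion e₂)ᴴ, inclusion_isometry,
      Matrix.one_mul]
  -- The projection R, conjugated by `U`, becomes an operator q on F alone; q inherits being a
  -- projection, and its range is F₂.
  obtain ⟨q, hq⟩ := exists_eq_kronecker
    (fun A => conj_comm_of_block_comm hU (Q := R) (h.block_actA_comm hU.2 e₂ A))
    (fun B => conj_comm_of_block_comm hU (Q := R) (h.block_actB_comm hU.2 e₂ B))
  have hq1 : U * actP aO bO R * Uᴴ = actF aI bI q := hq
  have hinj : Function.Injective (actF aI bI : Matrix f f ℂ → _) := by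
    intro M N hMN
    ext c c'
    have := congrFun (congrFun hMN (j₀, k₀, c)) (j₀, k₀, c')
    simpa [actF] using this
  have hq' : qᴴ = q := by
    apply hinj
    rw [← actF_conjTranspose, ← hq1, Matrix.conjTranspose_mul, Matrix.conjTranspose_mul,
      Matrix.conjTranspose_conjTranspose, actP_conjTranspose, hR', Matrix.mul_assoc]
  have hq'' : q * q = q := by
    apply hinj
    rw [actF_mul, ← hq1]
    calc U * actP aO bO R * Uᴴ * (U * actP aO bO R * Uᴴ)
        = U * actP aO bO R * (Uᴴ * U) * (actP aO bO R * Uᴴ) := by simp only [Matrix.mul_assoc]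
      _ = U * actP aO bO (R * R) * Uᴴ := by
          rw [hU.1, Matrix.mul_one, actP_mul R R]
          simp only [Matrix.mul_assoc]
      _ = U * actP aO bO R * Uᴴ := by rw [hR'']
  obtain ⟨F₂, hF₂⟩ := exists_subspace_of_projection hq' hq''
  let d₂ := stdOrthonormalBasis ℂ F₂
  let d₁ := stdOrthonormalBasis ℂ F₂ᗮ
  have hi₂ : actF aI bI (inclusion d₂ * (inclusion d₂)ᴴ) * U =
      U * actP aO bO (inclusion e₂ * (inclusion e₂)ᴴ) := by
    rw [hF₂, ← hq1, Matrix.mul_assoc, hU.1, Matrix.mul_one]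
  have hF : actF aI bI (inclusion d₁ * (inclusion d₁)ᴴ) +
      actF aI bI (inclusion d₂ * (inclusion d₂)ᴴ) = 1 := by
    rw [← actF_one (f := f), ← inclusion_add_orthogonal d₂ d₁]
    simp only [actF, Matrix.kronecker_add]
  have hP : actP aO bO (inclusion e₁ * (inclusion e₁)ᴴ) +
      actP aO bO (inclusion e₂ * (inclusion e₂)ᴴ) = 1 := by
    rw [← actP_one (p := p), ← inclusion_add_orthogonal e₂ e₁]
    simp only [actP, Matrix.add_kronecker]
  -- The intertwining relation for the complements follows by subtraction from the identity.
  have hi₁ : actF aI bI (inclusion d₁ * (inclusion d₁)ᴴ) * U =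
      U * actP aO bO (inclusion e₁ * (inclusion e₁)ᴴ) := by
    rw [eq_sub_of_add_eq hF, eq_sub_of_add_eq hP, Matrix.sub_mul, Matrix.mul_sub, hi₂,
      Matrix.one_mul, Matrix.mul_one]
  have hu₁ := isUnitary_restriction hU hi₁
  have hu₂ := isUnitary_restriction hU hi₂
  have hc₁ := h.combConditions_restriction hU.2 hi₁ (offA_mul_inclusion e₁)
  have hc₂ := h.combConditions_swapOperator_restriction hU.2 hi₂ (h.offB_mul_inclusion hU.2 e₂)
  refine ⟨P₂ᗮ, P₂, F₂ᗮ, F₂, Submodule.isOrtho_orthogonal_left P₂, ?_,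
    Submodule.isOrtho_orthogonal_left F₂, ?_, _, _, _, _, e₁, e₂, d₁, d₂, restriction e₁ d₁ U,
    restriction e₂ d₂ U, hu₁, hc₁.isCombAB hu₁.1, hu₂, ?_, ?_⟩
  · rw [sup_comm, Submodule.sup_orthogonal_of_hasOrthogonalProjection]
  · rw [sup_comm, Submodule.sup_orthogonal_of_hasOrthogonalProjection]
  · rw [IsCombBA, swapSlots_choiProj]
    exact hc₂.isCombAB (swapOperator_isometry hu₂.1)
  · rw [extendByZero_restriction hi₁, extendByZero_restriction hi₂, ← Matrix.mul_add, hP,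
      Matrix.mul_one]

end Restriction

end PureSuperchannel

end

theorem mainTheorem1 {p aI aO bI bO f : Type*}
    [Fintype p] [DecidableEq p] [Fintype f] [DecidableEq f]
    [Fintype aI] [DecidableEq aI] [Nonempty aI] [Fintype aO] [DecidableEq aO] [Nonempty aO]
    [Fintype bI] [DecidableEq bI] [Nonempty bI] [Fintype bO] [DecidableEq bO] [Nonempty bO]
    (U : Matrix (aI × bI × f) (p × aO × bO) ℂ) (hU : PureSuperchannel.IsUnitary U) :
    List.TFAE
      [PureSuperchannel.RepresentsPureSuperchannel U,
       PureSuperchannel.OrthogonalityConditions U,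
       PureSuperchannel.IsDirectSumOfPureCombs U] := by
  tfae_have 1 ↔ 2 := ⟨fun h => h.gramConditions.orthogonalityConditions, fun h =>
    (PureSuperchannel.gramConditions_of_orthogonalityConditions h).representsPureSuperchannel hU⟩
  tfae_have 2 ↔ 3 := ⟨fun h =>
    (PureSuperchannel.gramConditions_of_orthogonalityConditions h).isDirectSumOfPureCombs hU,
    fun h => h.gramConditions.orthogonalityConditions⟩
  tfae_finish
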